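/- Let $N\ge 2$ and let $\Omega\subset\mathbb R^N$ be a bounded domain with $C^{1,1}$ boundary $\Gamma$, described by a fixed system of local coordinates $\{(U_r,y_r,\varphi_r)\}_{r=1}^M$ with numbers $\alpha,\beta>0$: the open sets $U_r$ cover $\Gamma$; $y_r=(y_r',y_{rN})$ is obtained from the original coordinate $x$ by a rigid motion; $\varphi_r$ is $C^{1,1}$ (differentiable with Lipschitz gradient) on $\Delta_r=\{|y_r'|<\alpha\}$; and in $U_r$ the sets $\Gamma$, $\Omega$, $\overline\Omega^{\,c}$ are respectively given by $y_r'\in\Delta_r$ together with $y_{rN}=\varphi_r(y_r')$, $\ \varphi_r(y_r')<y_{rN}<\varphi_r(y_r')+\beta$, $\ \varphi_r(y_r')-\beta<y_{rN}<\varphi_r(y_r')$. Let $n$ be the outer unit normal on $\Gamma$, let $d$ be the signed distance to $\Gamma$ (negative in $\Omega$), and let $\pi(x)\in\Gamma$ denote the point with $x=\pi(x)+d(x)\,n(\pi(x))$. Then there is a constant $\tilde C_{0E}$, depending only on $N$ and $\Gamma$ (with its local coordinates), and for every $\sigma>0$ there are constants $\tilde C_{1E}$ and $h_*>0$, depending only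 on $N$, $\Gamma$ (with its local coordinates) and $\sigma$, such that the following holds for every $0<h<h_*$. Let $\mathcal T_h$ be a finite face-to-face mesh of closed $N$-simplices with $h_T:=\operatorname{diam}T\le h$ and $h_T\le\sigma\rho_T$ for all $T\in\mathcal T_h$, where $\rho_T$ is the diameter of the inscribed ball of $T$. Let $\Omega_h$ be the union of the simplices, $\mathcal S_h$ the set of $(N-1)$-faces of elements lying on $\partial\Omega_h$, and $\Gamma_h=\bigcup_{S\in\mathcal S_h}S$. Assume that all vertices of every $S\in\mathcal S_h$ lie on $\Gamma$ and that, for every $r$, $\Gamma_h\cap U_r$ is the graph $\{y_{rN}=\varphi_{rh}(y_r'),\ y_r'\in\Delta_r\}$ of a continuous function $\varphi_{rh}$. Then: (i) $\pi(x)$ exists and is unique for every $x\in\Gamma_h$, and $\pi|_{\Gamma_h}:\Gamma_h\to\Gamma$ is a bijection, whose inverse has the form $\pi^*(p)=p+t^*(p)\,n(p)$ with a real-valued function $t^*$ on $\Gamma$. (ii) For every $S\in\mathcal S_h$ there is an $r$ with $S\cup\pi(S)\subset U_r$. For every such $r$, let $S'=\{y_r' : y_r\in\pi(S)\}\subset\mathbb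 R^{N-1}$ be the common base set of $S$ and $\pi(S)$, and write $t^*(y')$ for $t^*$ at the point of $\Gamma$ with local coordinates $(y',\varphi_r(y'))$. Then $t^*$ is Lipschitz continuous on $S'$, hence differentiable almost everywhere there, and $$\|t^*\|_{L^\infty(S')}\le\tilde C_{0E}\,h^2,\qquad \|\nabla' t^*\|_{L^\infty(S')}\le\tilde C_{1E}\,h .$$ -/

import Mathlib

open Set MeasureTheory

noncomputable section

/-- Euclidean space of dimension `n`. -/
abbrev Euc (n : ℕ) : Type := EuclideanSpace ℝ (Fin n)

/-- Data of one local coordinate system near a boundary: an open set `U`, rotated (and translated)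
orthonormal coordinates `x ↦ (y', y_N)` and a height function `φ` of `y'`. -/
structure BoundaryChart (N : ℕ) where
  U : Set (Euc N)
  coord : Euc N ≃ᵃⁱ[ℝ] WithLp 2 (Euc (N - 1) × ℝ)
  φ : Euc (N - 1) → ℝ

namespace BoundaryChart

variable {N : ℕ}

/-- The projection to the base set, `b(x) = y'`. -/
def base (c : BoundaryChart N) (x : Euc N) : Euc (N - 1) := (c.coord x).fst

/-- The last coordinate `y_N` of `x`. -/
def height (c : BoundaryChart N) (x : Euc N) : ℝ := (c.coord x).snd

/-- The parametrization `Φ(y') = (y', φ(y'))`, as a point of the original space. -/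
def param (c : BoundaryChart N) (y : Euc (N - 1)) : Euc N :=
  c.coord.symm (WithLp.toLp 2 (y, c.φ y))

end BoundaryChart

/-- `f` is of class `C^{1,1}` on the (bounded, convex, open) set `D`: it is differentiable with
Lipschitz continuous gradient. -/
def IsC11On {n : ℕ} (f : Euc n → ℝ) (D : Set (Euc n)) : Prop :=
  DifferentiableOn ℝ f D ∧ ∃ K : NNReal, LipschitzOnWith K (gradient f) D

/-- The charts `c r` form a `C^{1,1}` system of local coordinates of the boundary of `Ω`, with base
sets `Δ = {|y'| < α}` and with `Ω` lying above the graphs, up to height `β`. -/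
structure IsC11ChartSystem {N M : ℕ} (Ω : Set (Euc N)) (α β : ℝ)
    (c : Fin M → BoundaryChart N) : Prop where
  alpha_pos : 0 < α
  beta_pos : 0 < β
  isOpen_U : ∀ r, IsOpen (c r).U
  cover : frontier Ω ⊆ ⋃ r, (c r).U
  regular : ∀ r, IsC11On (c r).φ (Metric.ball 0 α)
  boundary_eq : ∀ r, frontier Ω ∩ (c r).U =
    {x | (c r).base x ∈ Metric.ball 0 α ∧ (c r).height x = (c r).φ ((c r).base x)}
  inside_eq : ∀ r, Ω ∩ (c r).U =
    {x | (c r).base x ∈ Metric.ball 0 α ∧ (c r).φ ((c r).base x) < (c r).height x ∧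
      (c r).height x < (c r).φ ((c r).base x) + β}
  outside_eq : ∀ r, (closure Ω)ᶜ ∩ (c r).U =
    {x | (c r).base x ∈ Metric.ball 0 α ∧ (c r).φ ((c r).base x) - β < (c r).height x ∧
      (c r).height x < (c r).φ ((c r).base x)}

section Geometry

variable {N : ℕ}

/-- `ν` is the outer unit normal of `Ω` at the boundary point `p`: near `p`, up to a cone of
arbitrarily small opening around the hyperplane `ν^⊥`, the set `Ω` is the half space
`⟨z - p, ν⟩ < 0` and its exterior is the half space `⟨z - p, ν⟩ > 0`. -/
def IsOuterUnitNormal (Ω : Set (Euc N)) (p ν : Euc N) : Prop :=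
  ‖ν‖ = 1 ∧ ∀ ε : ℝ, 0 < ε → ∃ ρ : ℝ, 0 < ρ ∧ ∀ z ∈ Metric.ball p ρ,
    (inner ℝ (z - p) ν < -(ε * ‖z - p‖) → z ∈ Ω) ∧
    (ε * ‖z - p‖ < inner ℝ (z - p) ν → z ∉ closure Ω)

/-- The outer unit normal `n(p)`. -/
def outerNormal (Ω : Set (Euc N)) (p : Euc N) : Euc N :=
  Classical.epsilon fun ν => IsOuterUnitNormal Ω p ν

open Classical in
/-- The signed distance to the boundary of `Ω`, negative inside. -/
def bdrySignedDist (Ω : Set (Euc N)) (x : Euc N) : ℝ :=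
  if x ∈ Ω then -Metric.infDist x (frontier Ω) else Metric.infDist x (frontier Ω)

/-- `p` is a point of `Γ = ∂Ω` with `x = p + d(x) n(p)`. -/
def IsOrthProj (Ω : Set (Euc N)) (x p : Euc N) : Prop :=
  p ∈ frontier Ω ∧ x = p + bdrySignedDist Ω x • outerNormal Ω p

/-- The orthogonal projection `π` onto `Γ = ∂Ω` (meaningful where the point `p` of
`IsOrthProj` is unique). -/
def orthProj (Ω : Set (Euc N)) (x : Euc N) : Euc N :=
  Classical.epsilon fun p => IsOrthProj Ω x p

end Geometry

section Mesh

variable {N : ℕ}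

/-- The closed simplex spanned by a finite set of vertices. -/
def simplexOf (s : Finset (Euc N)) : Set (Euc N) := convexHull ℝ (s : Set (Euc N))

/-- Diameter of the inscribed ball: the supremum of the diameters of the balls contained in `T`. -/
def inscribedDiam (T : Set (Euc N)) : ℝ :=
  sSup {d : ℝ | 0 ≤ d ∧ ∃ x, Metric.closedBall x (d / 2) ⊆ T}

/-- A finite face-to-face mesh of `N`-simplices in `ℝ^N`, given by their vertex sets, with mesh size
at most `h` and shape regularity constant `σ`. -/
structure IsRegularMesh (𝒯 : Finset (Finset (Euc N))) (h σ : ℝ) : Prop where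
  card_eq : ∀ s ∈ 𝒯, s.card = N + 1
  indep : ∀ s ∈ 𝒯, AffineIndependent ℝ ((↑) : s → Euc N)
  diam_le : ∀ s ∈ 𝒯, Metric.diam (simplexOf s) ≤ h
  inter_eq : ∀ s ∈ 𝒯, ∀ t ∈ 𝒯,
    simplexOf s ∩ simplexOf t = convexHull ℝ ((s : Set (Euc N)) ∩ (t : Set (Euc N)))
  shape : ∀ s ∈ 𝒯, Metric.diam (simplexOf s) ≤ σ * inscribedDiam (simplexOf s)

/-- The closed polyhedral region `Ω_h` covered by the mesh. -/
def meshRegion (𝒯 : Finset (Finset (Euc N))) : Set (Euc N) := ⋃ s ∈ 𝒯, simplexOf s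

/-- The boundary mesh: (vertex sets of) the `(N-1)`-faces of the elements that lie on `∂Ω_h`. -/
def boundaryFaces (𝒯 : Finset (Finset (Euc N))) : Set (Finset (Euc N)) :=
  {F | F.card = N ∧ (∃ s ∈ 𝒯, F ⊆ s) ∧ simplexOf F ⊆ frontier (meshRegion 𝒯)}

/-- The discrete boundary `Γ_h`, the union of the boundary faces. -/
def meshBoundary (𝒯 : Finset (Finset (Euc N))) : Set (Euc N) :=
  ⋃ F ∈ boundaryFaces 𝒯, simplexOf F

/-- Compatibility of a mesh with `Γ = ∂Ω` and its local coordinates: the boundary vertices lie on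
`Γ`, and `Γ_h ∩ U_r` is the graph of a continuous function over `Δ_r` for every `r`. -/
structure IsCompatibleMesh {M : ℕ} (Ω : Set (Euc N)) (α : ℝ) (c : Fin M → BoundaryChart N)
    (𝒯 : Finset (Finset (Euc N))) : Prop where
  vertices_mem : ∀ F ∈ boundaryFaces 𝒯, ∀ v ∈ F, v ∈ frontier Ω
  graph : ∀ r, ∃ φh : Euc (N - 1) → ℝ, ContinuousOn φh (Metric.ball 0 α) ∧
    meshBoundary 𝒯 ∩ (c r).U =
      {x | (c r).base x ∈ Metric.ball 0 α ∧ (c r).height x = φh ((c r).base x)}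

/-- The inverse `π^* : Γ → Γ_h` of the restriction of `π` to `Γ_h`. -/
def projInv (Ω : Set (Euc N)) (𝒯 : Finset (Finset (Euc N))) (p : Euc N) : Euc N :=
  Function.invFunOn (orthProj Ω) (meshBoundary 𝒯) p

/-- The normal displacement `t^*`, the coefficient in `π^*(p) = p + t^*(p) n(p)`. -/
def normalDisp (Ω : Set (Euc N)) (𝒯 : Finset (Finset (Euc N))) (p : Euc N) : ℝ :=
  inner ℝ (projInv Ω 𝒯 p - p) (outerNormal Ω p)

end Mesh

/-- The common base set `S' = b(π(S))` of `S` and `π(S)`. -/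
def baseSet {N : ℕ} (Ω : Set (Euc N)) (c : BoundaryChart N) (F : Finset (Euc N)) :
    Set (Euc (N - 1)) :=
  c.base '' (orthProj Ω '' simplexOf F)

/-- The normal displacement as a function of the base variable: `y' ↦ t^*(Φ(y'))`. -/
def chartDisp {N : ℕ} (Ω : Set (Euc N)) (𝒯 : Finset (Finset (Euc N))) (c : BoundaryChart N)
    (y : Euc (N - 1)) : ℝ :=
  normalDisp Ω 𝒯 (c.param y)

end

/-!
The proof uses the `C^{1,1}` regularity of `Γ = ∂Ω` mainly in an intrinsic form
(`HasLipschitzNormal`): the outer normal `n` is Lipschitz on `Γ`, and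
`|⟨p - q, n(q)⟩| ≤ L |p - q|²` for `p, q ∈ Γ`. In a chart, `n` is the normalized vector `(∇φ, -1)`
(`outerNormal_chart`), so that nearby points are compared in a common chart, while far apart points
are covered by the choice of `L`.

*Projection.* A nearest boundary point `p` of `x` satisfies `x = p + d(x) n(p)`, because the ball
around `x` touching `Γ` at `p` lies on one side of `Γ` (`HasLipschitzNormal.exists_isOrthProj`). In
a tubular neighbourhood, the quadratic estimate makes `(p, t) ↦ p + t n(p)` injective
(`HasLipschitzNormal.normalCoords_injective`). Hence `π` is well defined near `Γ`, and
`p + t n(p)` is projected to `p`.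

*Size of the displacement.* If `x` lies in a boundary face and `p = π(x)`, then
`d(x) = ⟨x - p, n(p)⟩` is a mean of the numbers `⟨v - p, n(p)⟩` for the vertices `v ∈ Γ` of the
face, which are at most `L (2h)²` (`IsRegularMesh.abs_bdrySignedDist_le`). No shape regularity is
involved, so `C₀ = 4L` is independent of `σ`.

*Slope of the displacement.* The edges of a face have normal components of second order in the
diameter of the element. A ball inscribed in the element bounds the coefficients in the
representation of a direction in the face by its edges, so all directions in the face have normal
components `O(h)` (`IsRegularMesh.abs_inner_face_le`). As `Γ_h` is locally a continuous graph
covered by finitely many faces, adding up increments along the curve in `Γ_h` over a segment of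
the base extends this to the chords of `Γ_h` between nearby points
(`IsCompatibleMesh.abs_inner_le`). Here the faces near a point must be known to stay in the chart
(`IsCompatibleMesh.face_subset_U`).
Comparing the normal coordinates of two points of `Γ_h` then gives
`|t*(p) - t*(q)| ≤ C h |p - q|` (`IsCompatibleMesh.abs_disp_sub_le`). The case `p = q` is the
injectivity of `π` on `Γ_h`; surjectivity is the intermediate value theorem on normal lines
(`IsCompatibleMesh.exists_add_smul_mem`). In base coordinates `t*` is thus Lipschitz with constant
`O(h)`, and Rademacher's theorem gives the gradient bound almost everywhere.
-/

/-! ### Geometry of a single chart -/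

namespace BoundaryChart

variable {N : ℕ} (c : BoundaryChart N)

/-- The downward, not normalized normal `(∇φ(y), -1)` of the graph of `φ` over `y`, as a vector of
the original space. -/
noncomputable def graphNormal (y : Euc (N - 1)) : Euc N :=
  c.coord.linearIsometryEquiv.symm (WithLp.toLp 2 (gradient c.φ y, (-1 : ℝ)))

lemma coord_sub (x z : Euc N) :
    c.coord.linearIsometryEquiv (x - z) = c.coord x - c.coord z := by
  have := c.coord.map_vsub x z
  simpa using this

lemma norm_sub_sq (x z : Euc N) :
    ‖x - z‖ ^ 2 = ‖c.base x - c.base z‖ ^ 2 + (c.height x - c.height z) ^ 2 := by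
  rw [← c.coord.linearIsometryEquiv.norm_map (x - z), c.coord_sub, WithLp.prod_norm_sq_eq_of_L2]
  simp [base, height]

lemma norm_base_sub_le (x z : Euc N) : ‖c.base x - c.base z‖ ≤ ‖x - z‖ := by
  refine abs_le_of_sq_le_sq' ?_ (norm_nonneg _) |>.2
  rw [c.norm_sub_sq]
  nlinarith [sq_nonneg (c.height x - c.height z)]

lemma abs_height_sub_le (x z : Euc N) : |c.height x - c.height z| ≤ ‖x - z‖ := by
  refine abs_le_of_sq_le_sq ?_ (norm_nonneg _)
  rw [c.norm_sub_sq]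
  nlinarith [sq_nonneg ‖c.base x - c.base z‖]

lemma norm_sub_le (x z : Euc N) :
    ‖x - z‖ ≤ ‖c.base x - c.base z‖ + |c.height x - c.height z| := by
  refine abs_le_of_sq_le_sq' ?_ (by positivity) |>.2
  rw [c.norm_sub_sq, ← sq_abs (c.height x - c.height z)]
  nlinarith [mul_nonneg (norm_nonneg (c.base x - c.base z)) (abs_nonneg (c.height x - c.height z))]

lemma inner_graphNormal (x z : Euc N) (y : Euc (N - 1)) :
    inner ℝ (x - z) (c.graphNormal y) =
      inner ℝ (c.base x - c.base z) (gradient c.φ y) - (c.height x - c.height z) := by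
  rw [← c.coord.linearIsometryEquiv.inner_map_map (x - z), c.coord_sub, graphNormal,
    LinearIsometryEquiv.apply_symm_apply, WithLp.prod_inner_apply]
  simp [base, height]
  ring

lemma norm_sub_graphNormal (y w : Euc (N - 1)) :
    ‖c.graphNormal y - c.graphNormal w‖ = ‖gradient c.φ y - gradient c.φ w‖ := by
  rw [graphNormal, graphNormal, ← map_sub, LinearIsometryEquiv.norm_map,
    ← sq_eq_sq₀ (norm_nonneg _) (norm_nonneg _), WithLp.prod_norm_sq_eq_of_L2]
  simp

lemma norm_graphNormal_sq (y : Euc (N - 1)) :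
    ‖c.graphNormal y‖ ^ 2 = ‖gradient c.φ y‖ ^ 2 + 1 := by
  rw [graphNormal, LinearIsometryEquiv.norm_map, WithLp.prod_norm_sq_eq_of_L2]
  simp

lemma one_le_norm_graphNormal (y : Euc (N - 1)) : 1 ≤ ‖c.graphNormal y‖ := by
  have := c.norm_graphNormal_sq y
  nlinarith [norm_nonneg (c.graphNormal y), sq_nonneg ‖gradient c.φ y‖]

lemma norm_graphNormal_le (y : Euc (N - 1)) : ‖c.graphNormal y‖ ≤ 1 + ‖gradient c.φ y‖ := by
  refine abs_le_of_sq_le_sq' ?_ (by positivity) |>.2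
  rw [c.norm_graphNormal_sq]
  nlinarith [norm_nonneg (gradient c.φ y)]

lemma coord_add_smul_graphNormal (x : Euc N) (t : ℝ) (y : Euc (N - 1)) :
    c.coord (x + t • c.graphNormal y) =
      c.coord x + t • WithLp.toLp 2 (gradient c.φ y, (-1 : ℝ)) := by
  have h := c.coord_sub (x + t • c.graphNormal y) x
  rw [add_sub_cancel_left, map_smul, graphNormal, LinearIsometryEquiv.apply_symm_apply] at h
  rw [graphNormal, h]; abel

lemma base_add_smul_graphNormal (x : Euc N) (t : ℝ) (y : Euc (N - 1)) :
    c.base (x + t • c.graphNormal y) = c.base x + t • gradient c.φ y := by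
  simp [base, coord_add_smul_graphNormal]

lemma height_add_smul_graphNormal (x : Euc N) (t : ℝ) (y : Euc (N - 1)) :
    c.height (x + t • c.graphNormal y) = c.height x - t := by
  simp [height, coord_add_smul_graphNormal]; ring

lemma continuous_base : Continuous c.base :=
  (WithLp.continuous_fst 2 _ _).comp c.coord.continuous

lemma continuous_height : Continuous c.height :=
  (WithLp.continuous_snd 2 _ _).comp c.coord.continuous

/-- The point with base `y` and height `s`. -/
noncomputable def ofCoords (y : Euc (N - 1)) (s : ℝ) : Euc N :=
  c.coord.symm (WithLp.toLp 2 (y, s))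

@[simp] lemma base_ofCoords (y : Euc (N - 1)) (s : ℝ) : c.base (c.ofCoords y s) = y := by
  simp [base, ofCoords]

@[simp] lemma height_ofCoords (y : Euc (N - 1)) (s : ℝ) : c.height (c.ofCoords y s) = s := by
  simp [height, ofCoords]

lemma ext_coords {x z : Euc N} (h₁ : c.base x = c.base z) (h₂ : c.height x = c.height z) :
    x = z := by
  have := c.norm_sub_sq x z
  rw [h₁, h₂] at this
  simpa [sub_eq_zero] using this

lemma continuous_ofCoords {X : Type*} [TopologicalSpace X] {f : X → Euc (N - 1)} {g : X → ℝ}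
    {s : Set X} (hf : ContinuousOn f s) (hg : ContinuousOn g s) :
    ContinuousOn (fun x => c.ofCoords (f x) (g x)) s := by
  unfold ofCoords
  refine c.coord.symm.continuous.comp_continuousOn ?_
  exact (WithLp.prod_continuous_toLp 2 _ _).comp_continuousOn (hf.prodMk hg)

end BoundaryChart

/-- Uniform bounds for a system of charts: every ball of radius `δ` around a boundary point lies in
one of the `U_r`, and the gradients of the height functions are bounded by `G` and Lipschitz with
constant `K`. -/
structure UniformCharts {N M : ℕ} (Ω : Set (Euc N)) (α : ℝ) (c : Fin M → BoundaryChart N)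
    (δ K G : ℝ) : Prop where
  delta_pos : 0 < δ
  K_nonneg : 0 ≤ K
  G_nonneg : 0 ≤ G
  exists_ball_subset : ∀ p ∈ frontier Ω, ∃ r, Metric.ball p δ ⊆ (c r).U
  differentiable : ∀ r, DifferentiableOn ℝ (c r).φ (Metric.ball 0 α)
  norm_gradient_le : ∀ r, ∀ y ∈ Metric.ball (0 : Euc (N - 1)) α, ‖gradient (c r).φ y‖ ≤ G
  norm_gradient_sub_le : ∀ r, ∀ y ∈ Metric.ball (0 : Euc (N - 1)) α,
    ∀ z ∈ Metric.ball (0 : Euc (N - 1)) α,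
      ‖gradient (c r).φ y - gradient (c r).φ z‖ ≤ K * ‖y - z‖

lemma isCompact_frontier_of_isBounded {N : ℕ} {Ω : Set (Euc N)} (hΩ : Bornology.IsBounded Ω) :
    IsCompact (frontier Ω) :=
  hΩ.isCompact_closure.of_isClosed_subset isClosed_frontier frontier_subset_closure

lemma IsC11ChartSystem.exists_uniformCharts {N M : ℕ} {Ω : Set (Euc N)} {α β : ℝ}
    {c : Fin M → BoundaryChart N} (hΩ : Bornology.IsBounded Ω) (hc : IsC11ChartSystem Ω α β c) :
    ∃ δ K G : ℝ, UniformCharts Ω α c δ K G := by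
  obtain ⟨δ, hδ, hball⟩ := lebesgue_number_lemma_of_metric
    (isCompact_frontier_of_isBounded hΩ) hc.isOpen_U hc.cover
  choose hd K hK using hc.regular
  have h0 : (0 : Euc (N - 1)) ∈ Metric.ball (0 : Euc (N - 1)) α :=
    Metric.mem_ball_self hc.alpha_pos
  have hKle : ∀ r, (K r : ℝ) ≤ ∑ s, (K s : ℝ) := fun r =>
    Finset.single_le_sum (f := fun s => (K s : ℝ)) (fun s _ => (K s).2) (Finset.mem_univ r)
  have hGle : ∀ r, ‖gradient (c r).φ 0‖ ≤ ∑ s, ‖gradient (c s).φ 0‖ := fun r =>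
    Finset.single_le_sum (f := fun s => ‖gradient (c s).φ 0‖) (fun s _ => norm_nonneg _)
      (Finset.mem_univ r)
  have hK0 : 0 ≤ ∑ s, (K s : ℝ) := Finset.sum_nonneg fun s _ => (K s).2
  have hlip : ∀ r, ∀ y ∈ Metric.ball (0 : Euc (N - 1)) α,
      ∀ z ∈ Metric.ball (0 : Euc (N - 1)) α,
      ‖gradient (c r).φ y - gradient (c r).φ z‖ ≤ (∑ s, (K s : ℝ)) * ‖y - z‖ := by
    intro r y hy z hz
    have := (hK r).dist_le_mul y hy z hz
    rw [dist_eq_norm, dist_eq_norm] at this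
    exact this.trans (mul_le_mul_of_nonneg_right (hKle r) (norm_nonneg _))
  refine ⟨δ, ∑ s, (K s : ℝ), ∑ s, ‖gradient (c s).φ 0‖ + (∑ s, (K s : ℝ)) * α, hδ, hK0, ?_,
    hball, hd, ?_, hlip⟩
  · have := hc.alpha_pos
    positivity
  · intro r y hy
    have h1 := hlip r y hy 0 h0
    have h2 : ‖y - 0‖ ≤ α := by simpa using (mem_ball_zero_iff.1 hy).le
    have h3 := norm_le_norm_add_norm_sub' (gradient (c r).φ y) (gradient (c r).φ 0)
    have h4 := mul_le_mul_of_nonneg_left h2 hK0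
    linarith [hGle r]

namespace UniformCharts

variable {N M : ℕ} {Ω : Set (Euc N)} {α δ K G : ℝ} {c : Fin M → BoundaryChart N}

lemma abs_taylor_le (hu : UniformCharts Ω α c δ K G) (r : Fin M) {y z : Euc (N - 1)}
    (hy : y ∈ Metric.ball (0 : Euc (N - 1)) α) (hz : z ∈ Metric.ball (0 : Euc (N - 1)) α) :
    |(c r).φ z - (c r).φ y - inner ℝ (z - y) (gradient (c r).φ y)| ≤ K * ‖z - y‖ ^ 2 := by
  have hseg : segment ℝ y z ⊆ Metric.ball 0 α := (convex_ball 0 α).segment_subset hy hz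
  have hder : ∀ x ∈ segment ℝ y z, HasFDerivWithinAt (c r).φ
      (InnerProductSpace.toDual ℝ _ (gradient (c r).φ x)) (segment ℝ y z) x := fun x hx =>
    (((hu.differentiable r).differentiableAt
      (Metric.isOpen_ball.mem_nhds (hseg hx))).hasGradientAt).hasFDerivAt.hasFDerivWithinAt
  have := Convex.norm_image_sub_le_of_norm_hasFDerivWithin_le' (C := K * ‖z - y‖)
    (φ := InnerProductSpace.toDual ℝ _ (gradient (c r).φ y)) hder ?_ (convex_segment y z)
    (left_mem_segment ℝ y z) (right_mem_segment ℝ y z)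
  · rw [Real.norm_eq_abs, InnerProductSpace.toDual_apply_apply, real_inner_comm] at this
    linarith
  · intro x hx
    rw [← map_sub, LinearIsometryEquiv.norm_map]
    refine (hu.norm_gradient_sub_le r x (hseg hx) y hy).trans ?_
    refine mul_le_mul_of_nonneg_left ?_ hu.K_nonneg
    rw [← dist_eq_norm, ← dist_eq_norm, dist_comm, dist_comm z y]
    have := dist_add_dist_of_mem_segment hx
    linarith [dist_nonneg (x := x) (y := z)]

lemma abs_sub_le (hu : UniformCharts Ω α c δ K G) (r : Fin M) {y z : Euc (N - 1)}
    (hy : y ∈ Metric.ball (0 : Euc (N - 1)) α) (hz : z ∈ Metric.ball (0 : Euc (N - 1)) α) :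
    |(c r).φ z - (c r).φ y| ≤ G * ‖z - y‖ := by
  refine (convex_ball 0 α).norm_image_sub_le_of_norm_hasFDerivWithin_le
    (f' := fun x => InnerProductSpace.toDual ℝ _ (gradient (c r).φ x)) (fun x hx => ?_)
    (fun x hx => ?_) hy hz
  · exact (((hu.differentiable r).differentiableAt
      (Metric.isOpen_ball.mem_nhds hx)).hasGradientAt).hasFDerivAt.hasFDerivWithinAt
  · rw [LinearIsometryEquiv.norm_map]
    exact hu.norm_gradient_le r x hx

end UniformCharts

lemma IsOpen.mem_or_mem_frontier_or_mem_compl_closure {X : Type*} [TopologicalSpace X] {Ω : Set X}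
    (hΩ : IsOpen Ω) (x : X) :
    x ∈ Ω ∨ x ∈ frontier Ω ∨ x ∈ (closure Ω)ᶜ := by
  rw [hΩ.frontier_eq]
  by_cases h1 : x ∈ Ω
  · exact Or.inl h1
  · by_cases h2 : x ∈ closure Ω
    · exact Or.inr (Or.inl ⟨h2, h1⟩)
    · exact Or.inr (Or.inr h2)

namespace IsC11ChartSystem

variable {N M : ℕ} {Ω : Set (Euc N)} {α β : ℝ} {c : Fin M → BoundaryChart N}

lemma base_mem_ball (hc : IsC11ChartSystem Ω α β c) (hΩ : IsOpen Ω) {r : Fin M} {x : Euc N}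
    (hx : x ∈ (c r).U) : (c r).base x ∈ Metric.ball 0 α := by
  rcases hΩ.mem_or_mem_frontier_or_mem_compl_closure x with h | h | h
  · have : x ∈ Ω ∩ (c r).U := ⟨h, hx⟩
    rw [hc.inside_eq] at this; exact this.1
  · have : x ∈ frontier Ω ∩ (c r).U := ⟨h, hx⟩
    rw [hc.boundary_eq] at this; exact this.1
  · have : x ∈ (closure Ω)ᶜ ∩ (c r).U := ⟨h, hx⟩
    rw [hc.outside_eq] at this; exact this.1

lemma height_eq (hc : IsC11ChartSystem Ω α β c) {r : Fin M} {x : Euc N}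
    (hx : x ∈ (c r).U) (hxΓ : x ∈ frontier Ω) :
    (c r).height x = (c r).φ ((c r).base x) := by
  have : x ∈ frontier Ω ∩ (c r).U := ⟨hxΓ, hx⟩
  rw [hc.boundary_eq] at this; exact this.2

lemma mem_of_lt_height (hc : IsC11ChartSystem Ω α β c) (hΩ : IsOpen Ω) {r : Fin M} {x : Euc N}
    (hx : x ∈ (c r).U) (h : (c r).φ ((c r).base x) < (c r).height x) : x ∈ Ω := by
  rcases hΩ.mem_or_mem_frontier_or_mem_compl_closure x with h' | h' | h'
  · exact h'
  · exact absurd (hc.height_eq hx h') h.ne'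
  · have : x ∈ (closure Ω)ᶜ ∩ (c r).U := ⟨h', hx⟩
    rw [hc.outside_eq] at this; exact absurd this.2.2 (not_lt.2 h.le)

lemma notMem_closure_of_height_lt (hc : IsC11ChartSystem Ω α β c) (hΩ : IsOpen Ω) {r : Fin M}
    {x : Euc N} (hx : x ∈ (c r).U) (h : (c r).height x < (c r).φ ((c r).base x)) :
    x ∉ closure Ω := by
  rcases hΩ.mem_or_mem_frontier_or_mem_compl_closure x with h' | h' | h'
  · have : x ∈ Ω ∩ (c r).U := ⟨h', hx⟩
    rw [hc.inside_eq] at this; exact absurd this.2.1 (not_lt.2 h.le)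
  · exact absurd (hc.height_eq hx h') h.ne
  · exact h'

lemma param_mem (hc : IsC11ChartSystem Ω α β c) (r : Fin M) {y : Euc (N - 1)}
    (hy : y ∈ Metric.ball 0 α) : (c r).param y ∈ frontier Ω ∩ (c r).U := by
  rw [hc.boundary_eq]
  have h1 : (c r).base ((c r).param y) = y := (c r).base_ofCoords y _
  have h2 : (c r).height ((c r).param y) = (c r).φ y := (c r).height_ofCoords y _
  exact ⟨by rwa [h1], by rw [h1, h2]⟩

end IsC11ChartSystem

/-! ### The outer unit normal -/

section Normal

variable {N : ℕ} {Ω : Set (Euc N)}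

lemma IsOuterUnitNormal.unique {p ν ν' : Euc N} (h : IsOuterUnitNormal Ω p ν)
    (h' : IsOuterUnitNormal Ω p ν') : ν = ν' := by
  by_contra hne
  -- a short move in direction `ν' - ν` would lead into `Ω` by `ν` and out of `Ω` by `ν'`
  have hlt : inner ℝ ν ν' < 1 := by
    refine lt_of_le_of_ne ?_ fun h1 => hne ((inner_eq_one_iff_of_norm_eq_one h.1 h'.1).1 h1)
    have := real_inner_le_norm ν ν'
    rwa [h.1, h'.1, one_mul] at this
  set w := ν' - ν with hw
  have hw0 : 0 < ‖w‖ := norm_pos_iff.2 (sub_ne_zero.2 (Ne.symm hne))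
  have i1 : inner ℝ w ν = inner ℝ ν ν' - 1 := by
    rw [hw, inner_sub_left, real_inner_self_eq_norm_sq, h.1, real_inner_comm]; norm_num
  have i2 : inner ℝ w ν' = 1 - inner ℝ ν ν' := by
    rw [hw, inner_sub_left, real_inner_self_eq_norm_sq, h'.1]; norm_num
  set ε := (1 - inner ℝ ν ν') / (2 * ‖w‖) with hε
  have hεpos : 0 < ε := div_pos (by linarith) (by linarith)
  have hεw : ε * ‖w‖ = (1 - inner ℝ ν ν') / 2 := by rw [hε]; field_simp
  obtain ⟨ρ, hρ, H⟩ := h.2 ε hεpos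
  obtain ⟨ρ', hρ', H'⟩ := h'.2 ε hεpos
  set t := min ρ ρ' / (2 * ‖w‖) with ht
  have htpos : 0 < t := div_pos (lt_min hρ hρ') (by linarith)
  have htw : t * ‖w‖ = min ρ ρ' / 2 := by rw [ht]; field_simp
  have hn : ‖p + t • w - p‖ = t * ‖w‖ := by
    rw [add_sub_cancel_left, norm_smul, Real.norm_of_nonneg htpos.le]
  have hz : ‖p + t • w - p‖ < min ρ ρ' := by
    rw [hn, htw]; linarith [lt_min hρ hρ']
  have m1 := (H (p + t • w) (by rw [mem_ball_iff_norm]; exact hz.trans_le (min_le_left _ _))).1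
  have m2 := (H' (p + t • w) (by rw [mem_ball_iff_norm]; exact hz.trans_le (min_le_right _ _))).2
  rw [hn, add_sub_cancel_left, real_inner_smul_left] at m1 m2
  refine m2 ?_ (subset_closure (m1 ?_))
  · rw [i2]; nlinarith
  · rw [i1]; nlinarith

lemma IsOuterUnitNormal.outerNormal_eq {p ν : Euc N} (h : IsOuterUnitNormal Ω p ν) :
    outerNormal Ω p = ν :=
  IsOuterUnitNormal.unique (Classical.epsilon_spec (p := fun ν => IsOuterUnitNormal Ω p ν) ⟨ν, h⟩) h

end Normal

section ChartNormal

variable {N M : ℕ} {Ω : Set (Euc N)} {α β δ K G : ℝ} {c : Fin M → BoundaryChart N}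

/-- In a chart, the outer normal at `p = (y, φ(y))` is the normalized vector `(∇φ(y), -1)`, as `Ω`
lies above the graph of `φ`. -/
lemma isOuterUnitNormal_chart (hΩ : IsOpen Ω) (hc : IsC11ChartSystem Ω α β c)
    (hu : UniformCharts Ω α c δ K G) {r : Fin M} {p : Euc N} (hp : p ∈ frontier Ω)
    (hpU : p ∈ (c r).U) :
    IsOuterUnitNormal Ω p
      (‖(c r).graphNormal ((c r).base p)‖⁻¹ • (c r).graphNormal ((c r).base p)) := by
  set m := (c r).graphNormal ((c r).base p) with hm
  have hs : 1 ≤ ‖m‖ := (c r).one_le_norm_graphNormal _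
  have hs0 : 0 < ‖m‖ := by linarith
  refine ⟨by rw [norm_smul, norm_inv, norm_norm, inv_mul_cancel₀ hs0.ne'], fun ε hε => ?_⟩
  obtain ⟨ρ₁, hρ₁, hball⟩ := Metric.isOpen_iff.1 (hc.isOpen_U r) p hpU
  have hK := hu.K_nonneg
  have hρpos : 0 < min ρ₁ (ε / (K + 1)) := lt_min hρ₁ (by positivity)
  refine ⟨min ρ₁ (ε / (K + 1)), hρpos, fun z hz => ?_⟩
  have hzU : z ∈ (c r).U := hball (Metric.ball_subset_ball (min_le_left _ _) hz)
  have hzn : ‖z - p‖ ≤ ε / (K + 1) := by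
    rw [mem_ball_iff_norm] at hz; exact (hz.trans_le (min_le_right _ _)).le
  have hKz : K * ‖z - p‖ ≤ ε := by
    rw [le_div_iff₀ (by positivity)] at hzn; nlinarith [norm_nonneg (z - p)]
  have hT := hu.abs_taylor_le r (hc.base_mem_ball hΩ hpU) (hc.base_mem_ball hΩ hzU)
  have hb := (c r).norm_base_sub_le z p
  have hT' : K * ‖(c r).base z - (c r).base p‖ ^ 2 ≤ ε * ‖z - p‖ := by
    have h2 : ‖(c r).base z - (c r).base p‖ ^ 2 ≤ ‖z - p‖ ^ 2 :=
      pow_le_pow_left₀ (norm_nonneg _) hb 2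
    have := mul_le_mul_of_nonneg_left h2 hK
    nlinarith [mul_le_mul_of_nonneg_right hKz (norm_nonneg (z - p))]
  have hinner := (c r).inner_graphNormal z p ((c r).base p)
  rw [← hm] at hinner
  have hpe := hc.height_eq hpU hp
  have key : ∀ a : ℝ, ‖m‖⁻¹ * a < -(ε * ‖z - p‖) → a < -(ε * ‖z - p‖) := by
    intro a ha
    rw [inv_mul_lt_iff₀ hs0] at ha
    have : 0 ≤ ε * ‖z - p‖ := by positivity
    nlinarith
  have hT'' := abs_le.1 hT
  rw [real_inner_smul_right]
  constructor
  · intro h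
    have h := key _ h
    exact hc.mem_of_lt_height hΩ hzU (by linarith [hT''.2])
  · intro h
    have h := key (-inner ℝ (z - p) m) (by linarith)
    exact hc.notMem_closure_of_height_lt hΩ hzU (by linarith [hT''.1])

lemma outerNormal_chart (hΩ : IsOpen Ω) (hc : IsC11ChartSystem Ω α β c)
    (hu : UniformCharts Ω α c δ K G) {r : Fin M} {p : Euc N} (hp : p ∈ frontier Ω)
    (hpU : p ∈ (c r).U) :
    outerNormal Ω p =
      ‖(c r).graphNormal ((c r).base p)‖⁻¹ • (c r).graphNormal ((c r).base p) :=
  (isOuterUnitNormal_chart hΩ hc hu hp hpU).outerNormal_eq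

lemma isOuterUnitNormal_outerNormal (hΩ : IsOpen Ω) (hc : IsC11ChartSystem Ω α β c)
    (hu : UniformCharts Ω α c δ K G) {p : Euc N} (hp : p ∈ frontier Ω) :
    IsOuterUnitNormal Ω p (outerNormal Ω p) := by
  obtain ⟨r, hr⟩ := mem_iUnion.1 (hc.cover hp)
  rw [outerNormal_chart hΩ hc hu hp hr]
  exact isOuterUnitNormal_chart hΩ hc hu hp hr

end ChartNormal

/-- The intrinsic form in which `C^{1,1}` regularity of `Γ = ∂Ω` is used: the outer normal is well
defined and Lipschitz, and `Γ` deviates quadratically from its tangent planes. -/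
structure HasLipschitzNormal {N : ℕ} (Ω : Set (Euc N)) (L : ℝ) : Prop where
  pos : 0 < L
  isNormal : ∀ p ∈ frontier Ω, IsOuterUnitNormal Ω p (outerNormal Ω p)
  normal_sub_le : ∀ p ∈ frontier Ω, ∀ q ∈ frontier Ω,
    ‖outerNormal Ω p - outerNormal Ω q‖ ≤ L * ‖p - q‖
  abs_inner_le : ∀ p ∈ frontier Ω, ∀ q ∈ frontier Ω,
    |inner ℝ (p - q) (outerNormal Ω q)| ≤ L * ‖p - q‖ ^ 2

lemma norm_inv_smul_sub_inv_smul_le {E : Type*} [NormedAddCommGroup E] [NormedSpace ℝ E] {a b : E}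
    (ha : 1 ≤ ‖a‖) (hb : 1 ≤ ‖b‖) : ‖‖a‖⁻¹ • a - ‖b‖⁻¹ • b‖ ≤ 2 * ‖a - b‖ := by
  have ha0 : 0 < ‖a‖ := by linarith
  have hb0 : 0 < ‖b‖ := by linarith
  have h1 : ‖a‖⁻¹ • a - ‖b‖⁻¹ • b = ‖a‖⁻¹ • ((a - b) + ((‖b‖ - ‖a‖) * ‖b‖⁻¹) • b) := by
    rw [smul_add, smul_sub, smul_smul, sub_mul, mul_inv_cancel₀ hb0.ne', mul_sub, mul_one,
      sub_smul, ← mul_assoc, inv_mul_cancel₀ ha0.ne', one_mul]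
    abel
  rw [h1, norm_smul, norm_inv, norm_norm, inv_mul_le_iff₀ ha0]
  have h2 : ‖((‖b‖ - ‖a‖) * ‖b‖⁻¹) • b‖ ≤ ‖a - b‖ := by
    rw [norm_smul, norm_mul, norm_inv, norm_norm, mul_assoc, inv_mul_cancel₀ hb0.ne', mul_one,
      norm_sub_rev a b]
    exact abs_norm_sub_norm_le b a
  have := norm_add_le (a - b) (((‖b‖ - ‖a‖) * ‖b‖⁻¹) • b)
  nlinarith [norm_nonneg (a - b)]

lemma UniformCharts.exists_hasLipschitzNormal {N M : ℕ} {Ω : Set (Euc N)} {α β δ K G : ℝ}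
    {c : Fin M → BoundaryChart N} (hΩ : IsOpen Ω) (hc : IsC11ChartSystem Ω α β c)
    (hu : UniformCharts Ω α c δ K G) : ∃ L, HasLipschitzNormal Ω L := by
  have hN := fun p hp => isOuterUnitNormal_outerNormal (p := p) hΩ hc hu hp
  have hδ := hu.delta_pos
  have hK := hu.K_nonneg
  have hδi : 0 < 2 / δ := by positivity
  refine ⟨2 / δ + 2 * K, by positivity, hN, fun p hp q hq => ?_, fun p hp q hq => ?_⟩
  · rcases le_or_gt δ ‖p - q‖ with hfar | hnear
    · have h1 := norm_sub_le (outerNormal Ω p) (outerNormal Ω q)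
      rw [(hN p hp).1, (hN q hq).1] at h1
      have h2 : 2 ≤ 2 / δ * ‖p - q‖ := by
        rw [div_mul_eq_mul_div, le_div_iff₀ hδ]; linarith
      nlinarith [mul_nonneg hK (norm_nonneg (p - q))]
    · obtain ⟨r, hr⟩ := hu.exists_ball_subset q hq
      have hpU : p ∈ (c r).U := hr (by rwa [mem_ball_iff_norm])
      have hqU : q ∈ (c r).U := hr (Metric.mem_ball_self hδ)
      rw [outerNormal_chart hΩ hc hu hp hpU, outerNormal_chart hΩ hc hu hq hqU]
      have h1 := norm_inv_smul_sub_inv_smul_le ((c r).one_le_norm_graphNormal ((c r).base p))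
        ((c r).one_le_norm_graphNormal ((c r).base q))
      rw [BoundaryChart.norm_sub_graphNormal] at h1
      have h2 := hu.norm_gradient_sub_le r _ (hc.base_mem_ball hΩ hpU) _ (hc.base_mem_ball hΩ hqU)
      have h3 := mul_le_mul_of_nonneg_left ((c r).norm_base_sub_le p q) hK
      nlinarith [mul_nonneg hδi.le (norm_nonneg (p - q))]
  · rcases le_or_gt δ ‖p - q‖ with hfar | hnear
    · have h1 := abs_real_inner_le_norm (p - q) (outerNormal Ω q)
      rw [(hN q hq).1, mul_one] at h1
      have h2 : 2 ≤ 2 / δ * ‖p - q‖ := by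
        rw [div_mul_eq_mul_div, le_div_iff₀ hδ]; linarith
      have h3 := mul_le_mul_of_nonneg_right h2 (norm_nonneg (p - q))
      nlinarith [mul_nonneg hK (sq_nonneg ‖p - q‖), norm_nonneg (p - q)]
    · obtain ⟨r, hr⟩ := hu.exists_ball_subset q hq
      have hpU : p ∈ (c r).U := hr (by rwa [mem_ball_iff_norm])
      have hqU : q ∈ (c r).U := hr (Metric.mem_ball_self hδ)
      have hs := (c r).one_le_norm_graphNormal ((c r).base q)
      have hs0 : 0 < ‖(c r).graphNormal ((c r).base q)‖ := by linarith
      rw [outerNormal_chart hΩ hc hu hq hqU, real_inner_smul_right,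
        BoundaryChart.inner_graphNormal, hc.height_eq hpU hp, hc.height_eq hqU hq, abs_mul, abs_inv,
        abs_norm, inv_mul_le_iff₀ hs0, ← abs_neg]
      have h1 := hu.abs_taylor_le r (hc.base_mem_ball hΩ hqU) (hc.base_mem_ball hΩ hpU)
      have h2 : ‖(c r).base p - (c r).base q‖ ^ 2 ≤ ‖p - q‖ ^ 2 :=
        pow_le_pow_left₀ (norm_nonneg _) ((c r).norm_base_sub_le p q) 2
      have h3 := mul_le_mul_of_nonneg_left h2 hK
      have h4 : 0 ≤ 2 / δ * ‖p - q‖ ^ 2 := by positivity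
      have h5 : 0 ≤ K * ‖p - q‖ ^ 2 := by positivity
      rw [neg_sub]
      have h6 : (2 / δ + 2 * K) * ‖p - q‖ ^ 2 ≤
          ‖(c r).graphNormal ((c r).base q)‖ * ((2 / δ + 2 * K) * ‖p - q‖ ^ 2) :=
        le_mul_of_one_le_left (by positivity) hs
      linarith

/-! ### The orthogonal projection onto the boundary -/

lemma IsPreconnected.subset_of_disjoint_frontier {X : Type*} [TopologicalSpace X] {s t : Set X}
    (hs : IsPreconnected s) (ht : IsOpen t) (hst : Disjoint s (frontier t))
    (hne : (s ∩ t).Nonempty) : s ⊆ t := by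
  have hcov : s ⊆ t ∪ (closure t)ᶜ := by
    intro x hx
    by_contra h
    simp only [mem_union, mem_compl_iff, not_or, not_not] at h
    exact disjoint_left.1 hst hx (ht.frontier_eq ▸ ⟨h.2, h.1⟩)
  refine hs.subset_left_of_subset_union ht isClosed_closure.isOpen_compl ?_ hcov hne
  exact disjoint_compl_right.mono_left subset_closure

section Projection

variable {N : ℕ} {Ω : Set (Euc N)}

lemma abs_bdrySignedDist (Ω : Set (Euc N)) (x : Euc N) :
    |bdrySignedDist Ω x| = Metric.infDist x (frontier Ω) := by
  unfold bdrySignedDist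
  split_ifs <;> simp [abs_of_nonneg Metric.infDist_nonneg]

/-- If all directions `w` with `⟨w, e⟩ > 0` have `⟨w, n⟩ ≤ 0`, then `e = -n` (test with
`w = e + n`). -/
lemma eq_neg_of_forall_inner_nonpos {E : Type*} [NormedAddCommGroup E] [InnerProductSpace ℝ E]
    {e n : E} (he : ‖e‖ = 1) (hn : ‖n‖ = 1)
    (h : ∀ w : E, 0 < inner ℝ w e → inner ℝ w n ≤ 0) : e = -n := by
  by_contra hne
  have hlt : inner ℝ e (-n) < 1 := by
    refine lt_of_le_of_ne ?_ fun h1 =>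
      hne ((inner_eq_one_iff_of_norm_eq_one he (by rwa [norm_neg])).1 h1)
    have := real_inner_le_norm e (-n)
    rwa [norm_neg, he, hn, one_mul] at this
  rw [inner_neg_right] at hlt
  have h1 : inner ℝ (e + n) e = 1 + inner ℝ e n := by
    rw [inner_add_left, real_inner_self_eq_norm_sq, he, real_inner_comm]; norm_num
  have h2 : inner ℝ (e + n) n = 1 + inner ℝ e n := by
    rw [inner_add_left, real_inner_self_eq_norm_sq, hn]; ring
  have := h (e + n) (by rw [h1]; linarith)
  rw [h2] at this; linarith

/-- A direction `w` pointing into a ball around `x` with `p` on its boundary stays in that ball for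
a short time. -/
lemma exists_add_smul_mem_ball {E : Type*} [NormedAddCommGroup E] [InnerProductSpace ℝ E]
    {x p w : E} (hw : 0 < inner ℝ w (x - p)) {ρ : ℝ} (hρ : 0 < ρ) :
    ∃ t : ℝ, 0 < t ∧ p + t • w ∈ Metric.ball x (dist x p) ∧ p + t • w ∈ Metric.ball p ρ := by
  have hw0 : 0 < ‖w‖ := norm_pos_iff.2 fun h => by simp [h] at hw
  set t := min (inner ℝ w (x - p) / ‖w‖ ^ 2) (ρ / (2 * ‖w‖)) with ht
  have htpos : 0 < t := lt_min (by positivity) (by positivity)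
  have h1 : t * ‖w‖ ^ 2 ≤ inner ℝ w (x - p) :=
    (le_div_iff₀ (by positivity)).1 (min_le_left _ _)
  have h2 : t * (2 * ‖w‖) ≤ ρ := (le_div_iff₀ (by positivity)).1 (min_le_right _ _)
  refine ⟨t, htpos, ?_, ?_⟩
  · rw [mem_ball_iff_norm, dist_eq_norm]
    refine lt_of_pow_lt_pow_left₀ 2 (norm_nonneg _) ?_
    have : p + t • w - x = t • w - (x - p) := by abel
    rw [this, @norm_sub_sq_real, norm_smul, real_inner_smul_left, Real.norm_of_nonneg htpos.le]
    nlinarith [mul_le_mul_of_nonneg_left h1 htpos.le, mul_pos htpos hw]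
  · rw [mem_ball_iff_norm, add_sub_cancel_left, norm_smul, Real.norm_of_nonneg htpos.le]
    nlinarith

/-- A nearest boundary point is an orthogonal projection: the ball around `x` that it touches lies
on one side of `Γ`, so that `n` has to be radial. -/
lemma HasLipschitzNormal.exists_isOrthProj {L : ℝ} (hL : HasLipschitzNormal Ω L) (hΩ : IsOpen Ω)
    (hΩb : Bornology.IsBounded Ω) (hne : (frontier Ω).Nonempty) (x : Euc N) :
    ∃ p, IsOrthProj Ω x p := by
  obtain ⟨p, hp, hd⟩ := (isCompact_frontier_of_isBounded hΩb).exists_infDist_eq_dist hne x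
  refine ⟨p, hp, ?_⟩
  have hν := hL.isNormal p hp
  rcases eq_or_ne x p with rfl | hxp
  · have : bdrySignedDist Ω x = 0 := by
      rw [← abs_eq_zero, abs_bdrySignedDist, hd, dist_self]
    simp [this]
  have hD : 0 < dist x p := dist_pos.2 hxp
  have hnorm : ‖x - p‖ = dist x p := (dist_eq_norm x p).symm
  have hdisj : Disjoint (Metric.ball x (dist x p)) (frontier Ω) := by
    rw [disjoint_left]
    intro z hz hzΓ
    have := Metric.infDist_le_dist_of_mem hzΓ (x := x)
    rw [Metric.mem_ball, dist_comm] at hz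
    linarith
  have hconn : IsPreconnected (Metric.ball x (dist x p)) := (convex_ball x _).isPreconnected
  set e := (dist x p)⁻¹ • (x - p) with he
  have hen : ‖e‖ = 1 := by
    rw [he, norm_smul, norm_inv, hnorm, Real.norm_of_nonneg hD.le, inv_mul_cancel₀ hD.ne']
  have hxe : x = p + dist x p • e := by
    rw [he, smul_smul, mul_inv_cancel₀ hD.ne', one_smul]; abel
  have hwe : ∀ w : Euc N, 0 < inner ℝ w e → 0 < inner ℝ w (x - p) := by
    intro w hw
    rw [he, real_inner_smul_right] at hw
    exact (pos_iff_pos_of_mul_pos hw).1 (inv_pos.2 hD)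
  unfold bdrySignedDist
  split_ifs with hxΩ
  · have hsub : Metric.ball x (dist x p) ⊆ Ω := hconn.subset_of_disjoint_frontier hΩ hdisj
      ⟨x, Metric.mem_ball_self hD, hxΩ⟩
    have : e = -outerNormal Ω p := by
      refine eq_neg_of_forall_inner_nonpos hen hν.1 fun w hw => ?_
      by_contra hpos
      push Not at hpos
      have hw0 : 0 < ‖w‖ := norm_pos_iff.2 fun h => by simp [h] at hw
      obtain ⟨ρ, hρ, H⟩ := hν.2 (inner ℝ w (outerNormal Ω p) / (2 * ‖w‖)) (by positivity)
      obtain ⟨t, ht, h1, h2⟩ := exists_add_smul_mem_ball (hwe w hw) hρ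
      refine (H _ h2).2 ?_ (subset_closure (hsub h1))
      rw [add_sub_cancel_left, norm_smul, real_inner_smul_left, Real.norm_of_nonneg ht.le]
      have : inner ℝ w (outerNormal Ω p) / (2 * ‖w‖) * (t * ‖w‖) =
          t * inner ℝ w (outerNormal Ω p) / 2 := by field_simp
      rw [this]; nlinarith [mul_pos ht hpos]
    rw [hd, neg_smul, ← smul_neg, ← this, ← hxe]
  · have hxc : x ∉ closure Ω := fun h => by
      have : x ∈ frontier Ω := hΩ.frontier_eq ▸ ⟨h, hxΩ⟩
      rw [Metric.infDist_zero_of_mem this] at hd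
      linarith
    have hsub : Metric.ball x (dist x p) ⊆ (Ω)ᶜ := by
      intro z hz hzΩ
      exact hxΩ (hconn.subset_of_disjoint_frontier hΩ hdisj ⟨z, hz, hzΩ⟩ (Metric.mem_ball_self hD))
    have : e = - -outerNormal Ω p := by
      refine eq_neg_of_forall_inner_nonpos hen (by rw [norm_neg]; exact hν.1) fun w hw => ?_
      by_contra hpos
      rw [inner_neg_right] at hpos
      push Not at hpos
      have hw0 : 0 < ‖w‖ := norm_pos_iff.2 fun h => by simp [h] at hw
      obtain ⟨ρ, hρ, H⟩ := hν.2 (-inner ℝ w (outerNormal Ω p) / (2 * ‖w‖)) (by positivity)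
      obtain ⟨t, ht, h1, h2⟩ := exists_add_smul_mem_ball (hwe w hw) hρ
      refine hsub h1 ((H _ h2).1 ?_)
      rw [add_sub_cancel_left, norm_smul, real_inner_smul_left, Real.norm_of_nonneg ht.le]
      have : -inner ℝ w (outerNormal Ω p) / (2 * ‖w‖) * (t * ‖w‖) =
          t * -inner ℝ w (outerNormal Ω p) / 2 := by field_simp
      rw [this]; nlinarith [mul_pos ht hpos]
    rw [neg_neg] at this
    rw [hd, ← this, ← hxe]

namespace HasLipschitzNormal

variable {L : ℝ}

lemma norm_normal (hL : HasLipschitzNormal Ω L) {p : Euc N} (hp : p ∈ frontier Ω) :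
    ‖outerNormal Ω p‖ = 1 := (hL.isNormal p hp).1

/-- Comparison of normal coordinates: `|t - s|` is controlled by the normal component of the
difference of `p + t n(p)` and `q + s n(q)`, up to a term quadratic in `p - q`. -/
lemma abs_sub_le (hL : HasLipschitzNormal Ω L) {p q : Euc N} (hp : p ∈ frontier Ω)
    (hq : q ∈ frontier Ω) {t s : ℝ} (hs : |s| * L ≤ 1) :
    |t - s| ≤ |inner ℝ ((p + t • outerNormal Ω p) - (q + s • outerNormal Ω q)) (outerNormal Ω p)|
      + 2 * L * ‖p - q‖ ^ 2 := by
  set n := outerNormal Ω p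
  set m := outerNormal Ω q
  have hn : ‖n‖ = 1 := hL.norm_normal hp
  have hm : ‖m‖ = 1 := hL.norm_normal hq
  have h1 : inner ℝ ((p + t • n) - (q + s • m)) n =
      -inner ℝ (q - p) n + (t - s) + s * (1 - inner ℝ m n) := by
    have : (p + t • n) - (q + s • m) = -(q - p) + t • n - s • m := by abel
    rw [this, inner_sub_left, inner_add_left, inner_neg_left, real_inner_smul_left,
      real_inner_smul_left, real_inner_self_eq_norm_sq, hn]
    ring
  have h2 := hL.abs_inner_le q hq p hp
  have h3 : ‖n - m‖ ^ 2 = 2 * (1 - inner ℝ m n) := by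
    rw [@norm_sub_sq_real, hn, hm, real_inner_comm]; ring
  have h4 := pow_le_pow_left₀ (norm_nonneg _) (hL.normal_sub_le p hp q hq) 2
  have h5 : |s * (1 - inner ℝ m n)| ≤ L * ‖p - q‖ ^ 2 := by
    have h6 : 0 ≤ 1 - inner ℝ m n := by nlinarith [sq_nonneg ‖n - m‖]
    rw [abs_mul, abs_of_nonneg h6]
    have h7 : 1 - inner ℝ m n ≤ L ^ 2 * ‖p - q‖ ^ 2 := by nlinarith [sq_nonneg ‖n - m‖]
    have h8 : 0 ≤ L * ‖p - q‖ ^ 2 := mul_nonneg hL.pos.le (sq_nonneg _)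
    calc |s| * (1 - inner ℝ m n) ≤ |s| * (L ^ 2 * ‖p - q‖ ^ 2) :=
          mul_le_mul_of_nonneg_left h7 (abs_nonneg s)
      _ = (|s| * L) * (L * ‖p - q‖ ^ 2) := by ring
      _ ≤ 1 * (L * ‖p - q‖ ^ 2) := mul_le_mul_of_nonneg_right hs h8
      _ = L * ‖p - q‖ ^ 2 := one_mul _
  rw [norm_sub_rev q p] at h2
  have h6 : t - s = inner ℝ ((p + t • n) - (q + s • m)) n + inner ℝ (q - p) n -
      s * (1 - inner ℝ m n) := by rw [h1]; ring
  rw [h6]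
  refine (abs_sub _ _).trans ?_
  have := abs_add_le (inner ℝ ((p + t • n) - (q + s • m)) n) (inner ℝ (q - p) n)
  linarith

/-- The normal coordinates `p + t n(p)` determine `p` and `t` in a tubular neighbourhood. -/
lemma normalCoords_injective (hL : HasLipschitzNormal Ω L) {p q : Euc N} (hp : p ∈ frontier Ω)
    (hq : q ∈ frontier Ω) {t s τ : ℝ} (ht : |t| ≤ τ) (hs : |s| ≤ τ) (hτ : τ * L ≤ 1 / 16)
    (h : p + t • outerNormal Ω p = q + s • outerNormal Ω q) : p = q ∧ t = s := by
  have hL0 := hL.pos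
  have hsL : |s| * L ≤ 1 / 16 := (mul_le_mul_of_nonneg_right hs hL0.le).trans hτ
  have h1 := hL.abs_sub_le hp hq (t := t) (s := s) (by linarith)
  rw [h, sub_self, inner_zero_left, abs_zero, zero_add] at h1
  have hn : ‖outerNormal Ω p‖ = 1 := hL.norm_normal hp
  have hm : ‖outerNormal Ω q‖ = 1 := hL.norm_normal hq
  have h2 : p - q = s • outerNormal Ω q - t • outerNormal Ω p := by
    rw [sub_eq_sub_iff_add_eq_add, h, add_comm]
  have h3 : ‖p - q‖ ≤ 2 * τ := by
    rw [h2]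
    refine (norm_sub_le _ _).trans ?_
    rw [norm_smul, norm_smul, hn, hm, Real.norm_eq_abs, Real.norm_eq_abs]
    linarith
  have h4 : ‖p - q‖ ≤ |s| * (L * ‖p - q‖) + |t - s| := by
    have : p - q = s • (outerNormal Ω q - outerNormal Ω p) - (t - s) • outerNormal Ω p := by
      rw [h2, smul_sub, sub_smul]; abel
    calc ‖p - q‖ ≤ ‖s • (outerNormal Ω q - outerNormal Ω p)‖ + ‖(t - s) • outerNormal Ω p‖ := by
          rw [this]; exact norm_sub_le _ _
      _ ≤ _ := by
          rw [norm_smul, norm_smul, hn, mul_one, Real.norm_eq_abs, Real.norm_eq_abs, norm_sub_rev]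
          gcongr
          exact hL.normal_sub_le p hp q hq
  have h5 : ‖p - q‖ = 0 := by
    have h6 : L * ‖p - q‖ ^ 2 ≤ 1 / 8 * ‖p - q‖ := by
      have h7 := mul_le_mul_of_nonneg_left h3 hL0.le
      have h8 := mul_le_mul_of_nonneg_right (show L * ‖p - q‖ ≤ 1 / 8 by linarith)
        (norm_nonneg (p - q))
      nlinarith
    have h9 := mul_le_mul_of_nonneg_right hsL (norm_nonneg (p - q))
    nlinarith [norm_nonneg (p - q)]
  refine ⟨sub_eq_zero.1 (norm_eq_zero.1 h5), ?_⟩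
  rw [h5] at h1
  have : |t - s| ≤ 0 := by simpa using h1
  exact sub_eq_zero.1 (abs_nonpos_iff.1 this)

lemma existsUnique_isOrthProj (hL : HasLipschitzNormal Ω L) (hΩ : IsOpen Ω)
    (hΩb : Bornology.IsBounded Ω) (hne : (frontier Ω).Nonempty) {x : Euc N}
    (hx : Metric.infDist x (frontier Ω) * L ≤ 1 / 16) : ∃! p, IsOrthProj Ω x p := by
  obtain ⟨p, hp⟩ := hL.exists_isOrthProj hΩ hΩb hne x
  refine ⟨p, hp, fun q hq => ?_⟩
  have hd := (abs_bdrySignedDist Ω x).le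
  exact (hL.normalCoords_injective hq.1 hp.1 hd hd hx (hq.2.symm.trans hp.2)).1

/-- In a tubular neighbourhood, `p + t n(p)` has orthogonal projection `p` and signed distance
`t`. -/
lemma isOrthProj_add_smul (hL : HasLipschitzNormal Ω L) (hΩ : IsOpen Ω)
    (hΩb : Bornology.IsBounded Ω) {p : Euc N} (hp : p ∈ frontier Ω) {t : ℝ}
    (ht : |t| * L ≤ 1 / 16) :
    IsOrthProj Ω (p + t • outerNormal Ω p) p := by
  obtain ⟨q, hq⟩ := hL.exists_isOrthProj hΩ hΩb ⟨p, hp⟩ (p + t • outerNormal Ω p)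
  have hd : |bdrySignedDist Ω (p + t • outerNormal Ω p)| ≤ |t| := by
    rw [abs_bdrySignedDist]
    refine (Metric.infDist_le_dist_of_mem hp).trans ?_
    rw [dist_eq_norm, add_sub_cancel_left, norm_smul, hL.norm_normal hp, mul_one, Real.norm_eq_abs]
  obtain ⟨-, hts⟩ := hL.normalCoords_injective hp hq.1 le_rfl hd ht hq.2
  exact ⟨hp, by rw [← hts]⟩

end HasLipschitzNormal

lemma orthProj_eq {x p : Euc N} (h : ∃! q, IsOrthProj Ω x q) (hp : IsOrthProj Ω x p) :
    orthProj Ω x = p :=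
  h.unique (Classical.epsilon_spec (p := fun q => IsOrthProj Ω x q) h.exists) hp

end Projection

/-! ### Boundary faces of the mesh -/

section Faces

variable {N : ℕ}

lemma isBounded_simplexOf (s : Finset (Euc N)) : Bornology.IsBounded (simplexOf s) :=
  isBounded_convexHull.2 s.finite_toSet.isBounded

lemma isClosed_simplexOf (s : Finset (Euc N)) : IsClosed (simplexOf s) :=
  (s.finite_toSet.isCompact_convexHull (𝕜 := ℝ)).isClosed

lemma mem_simplexOf {s : Finset (Euc N)} {v : Euc N} (hv : v ∈ s) : v ∈ simplexOf s :=
  subset_convexHull ℝ _ (Finset.mem_coe.2 hv)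

lemma finite_boundaryFaces (𝒯 : Finset (Finset (Euc N))) : (boundaryFaces 𝒯).Finite := by
  classical
  refine (𝒯.biUnion Finset.powerset).finite_toSet.subset fun F hF => ?_
  obtain ⟨-, ⟨s, hs, hFs⟩, -⟩ := hF
  exact Finset.mem_coe.2 (Finset.mem_biUnion.2 ⟨s, hs, Finset.mem_powerset.2 hFs⟩)

lemma exists_mem_of_mem_boundaryFaces (hN : 2 ≤ N) {𝒯 : Finset (Finset (Euc N))}
    {F : Finset (Euc N)} (hF : F ∈ boundaryFaces 𝒯) : ∃ v, v ∈ F :=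
  Finset.card_pos.1 (by rw [hF.1]; omega)

variable {𝒯 : Finset (Finset (Euc N))} {h σ : ℝ}

lemma IsRegularMesh.norm_sub_le (hm : IsRegularMesh 𝒯 h σ) {F : Finset (Euc N)}
    (hF : F ∈ boundaryFaces 𝒯) {x z : Euc N} (hx : x ∈ simplexOf F) (hz : z ∈ simplexOf F) :
    ‖x - z‖ ≤ h := by
  obtain ⟨-, ⟨s, hs, hFs⟩, -⟩ := hF
  have hsub : simplexOf F ⊆ simplexOf s := convexHull_mono (Finset.coe_subset.2 hFs)
  rw [← dist_eq_norm]
  exact (Metric.dist_le_diam_of_mem (isBounded_simplexOf s) (hsub hx) (hsub hz)).trans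
    (hm.diam_le s hs)

/-- Shape regularity provides a ball in the simplex whose diameter is comparable to that of the
simplex. -/
lemma IsRegularMesh.exists_closedBall_subset (hm : IsRegularMesh 𝒯 h σ) (hN : 2 ≤ N)
    (hσ : 0 < σ) {s : Finset (Euc N)} (hs : s ∈ 𝒯) :
    ∃ d x, 0 < d ∧ Metric.diam (simplexOf s) ≤ 2 * σ * d ∧
      Metric.closedBall x (d / 2) ⊆ simplexOf s := by
  have hcard : 1 < s.card := by rw [hm.card_eq s hs]; omega
  obtain ⟨a, ha, b, hb, hab⟩ := Finset.one_lt_card.1 hcard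
  have hdiam : 0 < Metric.diam (simplexOf s) := (dist_pos.2 hab).trans_le
    (Metric.dist_le_diam_of_mem (isBounded_simplexOf s) (mem_simplexOf ha) (mem_simplexOf hb))
  have hshape := hm.shape s hs
  have hpos : 0 < inscribedDiam (simplexOf s) :=
    pos_of_mul_pos_right (hdiam.trans_le hshape) hσ.le
  have hne : {d : ℝ | 0 ≤ d ∧ ∃ x, Metric.closedBall x (d / 2) ⊆ simplexOf s}.Nonempty :=
    ⟨0, le_rfl, a, by simpa using mem_simplexOf ha⟩
  obtain ⟨d, ⟨-, x, hx⟩, hd⟩ := exists_lt_of_lt_csSup hne (half_lt_self hpos)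
  have hd : inscribedDiam (simplexOf s) / 2 < d := hd
  refine ⟨d, x, by linarith, hshape.trans ?_, hx⟩
  nlinarith

/-- Let `F` be a subset of the affinely independent vertices `s` of a simplex that contains a ball
of diameter `d`. Then `d` times a unit vector parallel to `F` is a combination of the vertices of
`F` with coefficients of modulus at most one and sum zero. -/
lemma exists_bounded_weights {s F : Finset (Euc N)} (hFs : F ⊆ s)
    (hind : AffineIndependent ℝ ((↑) : s → Euc N)) {d : ℝ} (hd : 0 < d) {x₀ : Euc N}
    (hball : Metric.closedBall x₀ (d / 2) ⊆ simplexOf s) {x z : Euc N}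
    (hx : x ∈ simplexOf F) (hz : z ∈ simplexOf F) (hxz : x ≠ z) :
    ∃ w : Euc N → ℝ, (∀ v ∈ F, |w v| ≤ 1) ∧ ∑ v ∈ F, w v = 0 ∧
      ∑ v ∈ F, w v • v = (d / ‖x - z‖) • (x - z) := by
  classical
  have hn : 0 < ‖x - z‖ := norm_pos_iff.2 (sub_ne_zero.2 hxz)
  obtain ⟨a, -, ha1, hax⟩ := Finset.mem_convexHull'.1 hx
  obtain ⟨b, -, hb1, hbz⟩ := Finset.mem_convexHull'.1 hz
  set e : Euc N := (d / 2 / ‖x - z‖) • (x - z) with he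
  have hen : ‖e‖ = d / 2 := by
    rw [he, norm_smul, Real.norm_of_nonneg (by positivity), div_mul_cancel₀ _ hn.ne']
  have hp : x₀ + e ∈ simplexOf s := hball (by simp [hen])
  have hq : x₀ - e ∈ simplexOf s := hball (by simp [hen])
  obtain ⟨l, hl0, hl1, hlx⟩ := Finset.mem_convexHull'.1 hp
  obtain ⟨k, hk0, hk1, hkx⟩ := Finset.mem_convexHull'.1 hq
  set ρ := d / ‖x - z‖ with hρ
  have hee : e + e = ρ • (x - z) := by rw [he, ← add_smul, hρ]; congr 1; ring
  -- the coefficients of `x - z` with respect to `F`, extended by zero to `s`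
  let g : Euc N → ℝ := fun v => if v ∈ F then ρ * (a v - b v) else 0
  have hg : ∀ v ∈ F, g v = ρ * (a v - b v) := fun v hv => if_pos hv
  have hg0 : ∑ v ∈ F, g v = 0 := by
    rw [Finset.sum_congr rfl hg, ← Finset.mul_sum, Finset.sum_sub_distrib, ha1, hb1, sub_self,
      mul_zero]
  have hgv : ∑ v ∈ F, g v • v = ρ • (x - z) := by
    rw [← hax, ← hbz, ← Finset.sum_sub_distrib, Finset.smul_sum]
    refine Finset.sum_congr rfl fun v hv => ?_
    rw [hg v hv, mul_smul, sub_smul]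
  have hgs0 : ∑ v ∈ s, g v = 0 := by
    rw [← hg0]
    exact (Finset.sum_subset hFs fun v _ hv => if_neg hv).symm
  have hgsv : ∑ v ∈ s, g v • v = ρ • (x - z) := by
    rw [← hgv]
    refine (Finset.sum_subset hFs fun v _ hv => ?_).symm
    rw [show g v = 0 from if_neg hv, zero_smul]
  have hzero : ∀ v ∈ s, l v - k v - g v = 0 := by
    have h1 := affineIndependent_iff.1 hind s.attach (fun v => l v - k v - g v) ?_ ?_
    · exact fun v hv => h1 ⟨v, hv⟩ (Finset.mem_attach _ _)
    · rw [s.sum_attach (fun v => l v - k v - g v), Finset.sum_sub_distrib, Finset.sum_sub_distrib,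
        hl1, hk1, hgs0]
      norm_num
    · rw [s.sum_attach (fun v => (l v - k v - g v) • v)]
      simp only [sub_smul, Finset.sum_sub_distrib]
      rw [hlx, hkx, hgsv, ← hee]
      abel
  refine ⟨g, fun v hv => ?_, hg0, hgv⟩
  have hvs := hFs hv
  have h1 : g v = l v - k v := by linarith [hzero v hvs]
  have hl := Finset.single_le_sum hl0 hvs
  have hk := Finset.single_le_sum hk0 hvs
  rw [h1, abs_le]
  constructor <;> linarith [hl0 v hvs, hk0 v hvs]

variable {Ω : Set (Euc N)} {L : ℝ}

/-- Boundary faces are almost tangential: the normal components of the edges are of second order by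
the quadratic deviation from the tangent plane, and shape regularity turns this into a first order
bound for all directions in the face. -/
lemma IsRegularMesh.abs_inner_face_le (hm : IsRegularMesh 𝒯 h σ) (hN : 2 ≤ N) (hσ : 0 < σ)
    (hL : HasLipschitzNormal Ω L) {F : Finset (Euc N)} (hF : F ∈ boundaryFaces 𝒯)
    (hFΓ : ∀ v ∈ F, v ∈ frontier Ω) {v p x z : Euc N} (hv : v ∈ F) (hp : p ∈ frontier Ω)
    (hx : x ∈ simplexOf F) (hz : z ∈ simplexOf F) :
    |inner ℝ (x - z) (outerNormal Ω p)| ≤ (2 * N * L * σ * h + L * ‖p - v‖) * ‖x - z‖ := by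
  rcases eq_or_ne x z with rfl | hxz
  · simp
  obtain ⟨hcard, ⟨s, hs, hFs⟩, -⟩ := id hF
  obtain ⟨d, x₀, hd, hdiam, hball⟩ := hm.exists_closedBall_subset hN hσ hs
  obtain ⟨w, hw1, hw0, hwv⟩ := exists_bounded_weights hFs (hm.indep s hs) hd hball hx hz hxz
  have hn : 0 < ‖x - z‖ := norm_pos_iff.2 (sub_ne_zero.2 hxz)
  set D := Metric.diam (simplexOf s) with hD
  have hD0 : 0 ≤ D := Metric.diam_nonneg
  have hDh : D ≤ h := hm.diam_le s hs
  have hL0 := hL.pos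
  have hvΓ := hFΓ v hv
  have h1 : |inner ℝ ((d / ‖x - z‖) • (x - z)) (outerNormal Ω v)| ≤ N * (L * D ^ 2) := by
    have : (d / ‖x - z‖) • (x - z) = ∑ u ∈ F, w u • (u - v) := by
      simp only [smul_sub, Finset.sum_sub_distrib, ← Finset.sum_smul, hw0, zero_smul, sub_zero, hwv]
    rw [this, sum_inner]
    refine (Finset.abs_sum_le_sum_abs _ _).trans ?_
    refine (Finset.sum_le_card_nsmul F _ (L * D ^ 2) fun u hu => ?_).trans_eq
      (by rw [hcard, nsmul_eq_mul])
    rw [real_inner_smul_left, abs_mul]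
    have h2 := hL.abs_inner_le u (hFΓ u hu) v hvΓ
    have h3 : ‖u - v‖ ≤ D := by
      rw [← dist_eq_norm]
      exact Metric.dist_le_diam_of_mem (isBounded_simplexOf s) (mem_simplexOf (hFs hu))
        (mem_simplexOf (hFs hv))
    have h4 := mul_le_mul_of_nonneg_left (pow_le_pow_left₀ (norm_nonneg _) h3 2) hL0.le
    exact (mul_le_of_le_one_left (abs_nonneg _) (hw1 u hu)).trans (h2.trans h4)
  rw [real_inner_smul_left, abs_mul, abs_of_pos (div_pos hd hn), div_mul_eq_mul_div,
    div_le_iff₀ hn] at h1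
  have h2 : |inner ℝ (x - z) (outerNormal Ω v)| ≤ 2 * N * L * σ * h * ‖x - z‖ := by
    refine le_of_mul_le_mul_left (h1.trans ?_) hd
    have h3 : D ^ 2 ≤ 2 * σ * d * h := by
      rw [sq]; exact mul_le_mul hdiam hDh hD0 (by positivity)
    have h4 : 0 ≤ N * L * ‖x - z‖ := by positivity
    nlinarith [mul_le_mul_of_nonneg_left h3 h4]
  have h3 : |inner ℝ (x - z) (outerNormal Ω p - outerNormal Ω v)| ≤
      ‖x - z‖ * (L * ‖p - v‖) :=
    (abs_real_inner_le_norm _ _).trans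
      (mul_le_mul_of_nonneg_left (hL.normal_sub_le p hp v hvΓ) hn.le)
  have h4 : inner ℝ (x - z) (outerNormal Ω p) = inner ℝ (x - z) (outerNormal Ω v) +
      inner ℝ (x - z) (outerNormal Ω p - outerNormal Ω v) := by
    rw [inner_sub_right]; ring
  rw [h4]
  exact (abs_add_le _ _).trans (by linarith)

lemma IsRegularMesh.infDist_le (hm : IsRegularMesh 𝒯 h σ) (hN : 2 ≤ N) {F : Finset (Euc N)}
    (hF : F ∈ boundaryFaces 𝒯) (hFΓ : ∀ v ∈ F, v ∈ frontier Ω) {x : Euc N}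
    (hx : x ∈ simplexOf F) : Metric.infDist x (frontier Ω) ≤ h := by
  obtain ⟨v, hv⟩ := exists_mem_of_mem_boundaryFaces hN hF
  refine (Metric.infDist_le_dist_of_mem (hFΓ v hv)).trans ?_
  rw [dist_eq_norm]
  exact hm.norm_sub_le hF hx (mem_simplexOf hv)

/-- Points of a boundary face have distance `O(h²)` to `Γ`: the normal component at the projection
is a mean of those of the vertices, which are of second order. -/
lemma IsRegularMesh.abs_bdrySignedDist_le (hm : IsRegularMesh 𝒯 h σ) (hN : 2 ≤ N)
    (hL : HasLipschitzNormal Ω L) {F : Finset (Euc N)} (hF : F ∈ boundaryFaces 𝒯)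
    (hFΓ : ∀ v ∈ F, v ∈ frontier Ω) {x p : Euc N} (hx : x ∈ simplexOf F)
    (hp : IsOrthProj Ω x p) : |bdrySignedDist Ω x| ≤ 4 * L * h ^ 2 := by
  have hd : |bdrySignedDist Ω x| ≤ h := by
    rw [abs_bdrySignedDist]; exact hm.infDist_le hN hF hFΓ hx
  have hn := hL.norm_normal hp.1
  have hxp : x - p = bdrySignedDist Ω x • outerNormal Ω p := by
    conv_lhs => rw [hp.2]
    rw [add_sub_cancel_left]
  have h1 : inner ℝ (x - p) (outerNormal Ω p) = bdrySignedDist Ω x := by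
    rw [hxp, real_inner_smul_left, real_inner_self_eq_norm_sq, hn]; ring
  have hxp' : ‖x - p‖ ≤ h := by rw [hxp, norm_smul, hn, mul_one]; exact hd
  obtain ⟨w, hw0, hw1, hwx⟩ := Finset.mem_convexHull'.1 hx
  have h2 : x - p = ∑ v ∈ F, w v • (v - p) := by
    simp only [smul_sub, Finset.sum_sub_distrib, ← Finset.sum_smul, hw1, one_smul, hwx]
  rw [← h1, h2, sum_inner]
  refine (Finset.abs_sum_le_sum_abs _ _).trans ?_
  have h3 : ∀ v ∈ F, |inner ℝ (w v • (v - p)) (outerNormal Ω p)| ≤ w v * (4 * L * h ^ 2) := by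
    intro v hv
    rw [real_inner_smul_left, abs_mul, abs_of_nonneg (hw0 v hv)]
    refine mul_le_mul_of_nonneg_left ?_ (hw0 v hv)
    refine (hL.abs_inner_le v (hFΓ v hv) p hp.1).trans ?_
    have h4 : ‖v - p‖ ≤ 2 * h := by
      have := norm_sub_le_norm_sub_add_norm_sub v x p
      linarith [hm.norm_sub_le hF (mem_simplexOf hv) hx]
    have h5 := mul_le_mul_of_nonneg_left (pow_le_pow_left₀ (norm_nonneg _) h4 2) hL.pos.le
    linarith
  refine (Finset.sum_le_sum h3).trans ?_
  rw [← Finset.sum_mul, hw1, one_mul]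

end Faces

/-! ### Piecewise Lipschitz functions on an interval -/

section Piecewise

variable {E : Type*} [TopologicalSpace E]

lemma sub_le_of_piecewise {f : ℝ → ℝ} {γ : ℝ → E} {𝓕 : Set (Set E)} {M : ℝ}
    (hf : ContinuousOn f (Icc 0 1)) (hγ : ContinuousOn γ (Icc 0 1)) (hfin : 𝓕.Finite)
    (hclosed : ∀ A ∈ 𝓕, IsClosed A) (hcov : ∀ t ∈ Icc (0 : ℝ) 1, ∃ A ∈ 𝓕, γ t ∈ A)
    (hM : ∀ A ∈ 𝓕, ∀ s ∈ Icc (0 : ℝ) 1, ∀ t ∈ Icc (0 : ℝ) 1, s < t → γ s ∈ A → γ t ∈ A →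
      f t - f s ≤ M * (t - s)) :
    f 1 - f 0 ≤ M := by
  have key := image_le_of_liminf_slope_right_le_deriv_boundary hf (B := fun t => f 0 + M * t)
    (B' := fun _ => M) (by simp) (by fun_prop)
    (fun x _ => by
      simpa using (((hasDerivAt_id x).const_mul M).const_add (f 0)).hasDerivWithinAt) ?_
    (right_mem_Icc.2 zero_le_one)
  · linarith
  intro t ht r hr
  have hmem : Ioc t 1 ∈ nhdsWithin t (Ioi t) := Ioc_mem_nhdsGT ht.2
  -- one of the finitely many pieces accumulates at `t` from the right, hence contains `γ t`
  have hex : ∃ A ∈ 𝓕, ∃ᶠ z in nhdsWithin t (Ioi t), γ z ∈ A := by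
    by_contra hcon
    push Not at hcon
    have h1 := (Filter.eventually_all_finite hfin).2 hcon
    obtain ⟨z, hz, hzm⟩ := (h1.and hmem).exists
    obtain ⟨A, hA, hzA⟩ := hcov z ⟨ht.1.trans hzm.1.le, hzm.2⟩
    exact hz A hA hzA
  obtain ⟨A, hA, hfreq⟩ := hex
  have htI : t ∈ Icc (0 : ℝ) 1 := ⟨ht.1, ht.2.le⟩
  have htend : Filter.Tendsto γ (nhdsWithin t (Ioi t)) (nhds (γ t)) := by
    refine (hγ t htI).mono_left ?_
    refine nhdsWithin_le_of_mem (Filter.mem_of_superset hmem fun z hz => ?_)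
    exact ⟨ht.1.trans hz.1.le, hz.2⟩
  have htA : γ t ∈ A := (hclosed A hA).mem_of_frequently_of_tendsto hfreq htend
  refine (hfreq.and_eventually hmem).mono fun z hz => lt_of_le_of_lt ?_ hr
  rw [slope_def_field, div_le_iff₀ (sub_pos.2 hz.2.1)]
  exact hM A hA t htI z ⟨ht.1.trans hz.2.1.le, hz.2.2⟩ hz.2.1 htA hz.1

/-- A continuous function on `[0, 1]` that has Lipschitz constant `M` along each of finitely many
closed pieces covering the interval changes by at most `M`. -/
lemma abs_sub_le_of_piecewise {f : ℝ → ℝ} {γ : ℝ → E} {𝓕 : Set (Set E)} {M : ℝ}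
    (hf : ContinuousOn f (Icc 0 1)) (hγ : ContinuousOn γ (Icc 0 1)) (hfin : 𝓕.Finite)
    (hclosed : ∀ A ∈ 𝓕, IsClosed A) (hcov : ∀ t ∈ Icc (0 : ℝ) 1, ∃ A ∈ 𝓕, γ t ∈ A)
    (hM : ∀ A ∈ 𝓕, ∀ s ∈ Icc (0 : ℝ) 1, ∀ t ∈ Icc (0 : ℝ) 1, s < t → γ s ∈ A → γ t ∈ A →
      |f t - f s| ≤ M * (t - s)) :
    |f 1 - f 0| ≤ M := by
  rw [abs_le']
  refine ⟨sub_le_of_piecewise hf hγ hfin hclosed hcov fun A hA s hs t ht hst h1 h2 =>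
    (le_abs_self _).trans (hM A hA s hs t ht hst h1 h2), ?_⟩
  have := sub_le_of_piecewise (f := fun t => -f t) hf.neg hγ hfin hclosed hcov
    (M := M) fun A hA s hs t ht hst h1 h2 => by
      have := (neg_le_abs _).trans (hM A hA s hs t ht hst h1 h2)
      linarith
  linarith

end Piecewise

/-! ### The discrete boundary in a chart -/

section ChartMesh

variable {N M : ℕ} {Ω : Set (Euc N)} {α β δ K G L h σ : ℝ} {c : Fin M → BoundaryChart N}
  {𝒯 : Finset (Finset (Euc N))}

/-- A boundary face that meets `U_r` and lies over the base set of the chart is contained in `U_r`: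
within `U_r` it lies on the graph of a function that is continuous up to the points where the face
would have to leave `U_r`. -/
lemma IsCompatibleMesh.face_subset_U (hcm : IsCompatibleMesh Ω α c 𝒯)
    (hc : IsC11ChartSystem Ω α β c) {r : Fin M} {F : Finset (Euc N)} (hF : F ∈ boundaryFaces 𝒯)
    (hbase : ∀ z ∈ simplexOf F, (c r).base z ∈ Metric.ball 0 α) {x : Euc N}
    (hx : x ∈ simplexOf F) (hxU : x ∈ (c r).U) : simplexOf F ⊆ (c r).U := by
  obtain ⟨φh, hcont, hgraph⟩ := hcm.graph r
  have hFh : simplexOf F ⊆ meshBoundary 𝒯 := fun z hz => mem_biUnion hF hz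
  set W : Set (Euc N) :=
    {z | (c r).base z ∈ Metric.ball 0 α ∧ (c r).height z - φh ((c r).base z) ≠ 0}
  have hW : IsOpen W := by
    have h1 : IsOpen ((c r).base ⁻¹' Metric.ball 0 α) :=
      Metric.isOpen_ball.preimage (c r).continuous_base
    have h2 : ContinuousOn (fun z => (c r).height z - φh ((c r).base z))
        ((c r).base ⁻¹' Metric.ball 0 α) :=
      (c r).continuous_height.continuousOn.sub
        (hcont.comp (c r).continuous_base.continuousOn fun z hz => hz)
    exact h2.isOpen_inter_preimage h1 isOpen_compl_singleton
  have hUgraph : ∀ z ∈ simplexOf F, z ∈ (c r).U → z ∉ W := by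
    intro z hz hzU hzW
    have : z ∈ meshBoundary 𝒯 ∩ (c r).U := ⟨hFh hz, hzU⟩
    rw [hgraph] at this
    exact hzW.2 (sub_eq_zero.2 this.2)
  have hcov : simplexOf F ⊆ (c r).U ∪ W := by
    intro z hz
    by_cases hzW : z ∈ W
    · exact Or.inr hzW
    · left
      have h3 : (c r).height z = φh ((c r).base z) := by
        by_contra hne
        exact hzW ⟨hbase z hz, sub_ne_zero.2 hne⟩
      have : z ∈ meshBoundary 𝒯 ∩ (c r).U := by
        rw [hgraph]; exact ⟨hbase z hz, h3⟩
      exact this.2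
  intro z hz
  by_contra hzU
  obtain ⟨u, huF, huU, huW⟩ := (convex_convexHull ℝ (F : Set (Euc N))).isPreconnected _ _
    (hc.isOpen_U r) hW hcov ⟨x, hx, hxU⟩ ⟨z, hz, (hcov hz).resolve_left hzU⟩
  exact hUgraph u huF huU huW

lemma IsC11ChartSystem.mem_ball_of_norm_sub_lt (hc : IsC11ChartSystem Ω α β c) (hΩ : IsOpen Ω)
    {r : Fin M} {p : Euc N} (hball : Metric.ball p δ ⊆ (c r).U) {y : Euc (N - 1)}
    (hy : ‖y - (c r).base p‖ < δ) : y ∈ Metric.ball 0 α := by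
  have h1 : (c r).ofCoords y ((c r).height p) ∈ (c r).U := hball <| by
    rw [mem_ball_iff_norm]
    refine ((c r).norm_sub_le _ _).trans_lt ?_
    simpa using hy
  simpa using hc.base_mem_ball hΩ h1

/-- The boundary faces over a neighbourhood of `p` stay close to `p`, and the discrete boundary is
close to `Γ` there. -/
lemma IsCompatibleMesh.face_near (hcm : IsCompatibleMesh Ω α c 𝒯)
    (hm : IsRegularMesh 𝒯 h σ) (hΩ : IsOpen Ω) (hc : IsC11ChartSystem Ω α β c)
    (hu : UniformCharts Ω α c δ K G) {r : Fin M} {p : Euc N} (hp : p ∈ frontier Ω)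
    (hball : Metric.ball p δ ⊆ (c r).U) {x : Euc N} (hxU : x ∈ (c r).U) {a : ℝ}
    (hxp : ‖(c r).base x - (c r).base p‖ ≤ a) (ha : a + h < δ) {F : Finset (Euc N)}
    (hF : F ∈ boundaryFaces 𝒯) (hx : x ∈ simplexOf F) {v : Euc N} (hv : v ∈ F) :
    ‖v - p‖ ≤ (1 + G) * (a + h) ∧
      |(c r).height x - (c r).φ ((c r).base x)| ≤ (1 + G) * h := by
  have hG := hu.G_nonneg
  have hnear : ∀ z ∈ simplexOf F, ‖(c r).base z - (c r).base p‖ ≤ a + h := by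
    intro z hz
    have h1 := hm.norm_sub_le hF hz hx
    have h2 := (c r).norm_base_sub_le z x
    have h3 := norm_sub_le_norm_sub_add_norm_sub ((c r).base z) ((c r).base x) ((c r).base p)
    linarith
  have hbase : ∀ z ∈ simplexOf F, (c r).base z ∈ Metric.ball 0 α := fun z hz =>
    hc.mem_ball_of_norm_sub_lt hΩ hball ((hnear z hz).trans_lt ha)
  have hsub := hcm.face_subset_U hc hF hbase hx hxU
  have hvF := mem_simplexOf hv
  have hvΓ := hcm.vertices_mem F hF v hv
  have hvU := hsub hvF
  have hpU : p ∈ (c r).U := hball (Metric.mem_ball_self hu.delta_pos)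
  have hve := hc.height_eq hvU hvΓ
  constructor
  · refine ((c r).norm_sub_le v p).trans ?_
    rw [hve, hc.height_eq hpU hp]
    have h1 := hu.abs_sub_le r (hc.base_mem_ball hΩ hpU) (hbase v hvF)
    nlinarith [hnear v hvF]
  · have h1 := hu.abs_sub_le r (hbase x hx) (hbase v hvF)
    have h2 := hm.norm_sub_le hF hvF hx
    have h3 := (c r).norm_base_sub_le v x
    have h4 := (c r).abs_height_sub_le v x
    rw [hve] at h4
    have h5 : G * ‖(c r).base v - (c r).base x‖ ≤ G * h :=
      mul_le_mul_of_nonneg_left (h3.trans h2) hG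
    have h6 : (c r).height x - (c r).φ ((c r).base x) =
      ((c r).φ ((c r).base v) - (c r).φ ((c r).base x)) -
        ((c r).φ ((c r).base v) - (c r).height x) := by ring
    rw [h6]
    refine (abs_sub _ _).trans ?_
    linarith

lemma IsCompatibleMesh.ofCoords_mem {r : Fin M} {φh : Euc (N - 1) → ℝ}
    (hgraph : meshBoundary 𝒯 ∩ (c r).U =
      {x | (c r).base x ∈ Metric.ball 0 α ∧ (c r).height x = φh ((c r).base x)})
    {y : Euc (N - 1)} (hy : y ∈ Metric.ball 0 α) :
    (c r).ofCoords y (φh y) ∈ meshBoundary 𝒯 ∩ (c r).U := by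
  rw [hgraph]
  exact ⟨by simpa using hy, by simp⟩

/-- The discrete boundary is almost tangential near `p`: the slope estimate on the single faces is
added up along the curve in `Γ_h` over the segment between the base points. -/
lemma IsCompatibleMesh.abs_inner_le (hcm : IsCompatibleMesh Ω α c 𝒯)
    (hm : IsRegularMesh 𝒯 h σ) (hN : 2 ≤ N) (hσ : 0 < σ) (hh : 0 < h) (hΩ : IsOpen Ω)
    (hc : IsC11ChartSystem Ω α β c) (hu : UniformCharts Ω α c δ K G)
    (hL : HasLipschitzNormal Ω L) {C : ℝ} (hC : C = 2 * N * L * σ + 3 * L * (1 + G))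
    (hδ : 3 * h < δ) (hCh : (1 + G) * (C * h) ≤ 1 / 2) {p x z : Euc N} (hp : p ∈ frontier Ω)
    (hx : x ∈ meshBoundary 𝒯) (hz : z ∈ meshBoundary 𝒯) (hxp : ‖x - p‖ ≤ 2 * h)
    (hzp : ‖z - p‖ ≤ 2 * h) :
    |inner ℝ (x - z) (outerNormal Ω p)| ≤ 2 * (1 + G) ^ 2 * C * h * ‖x - z‖ := by
  obtain ⟨r, hball⟩ := hu.exists_ball_subset p hp
  obtain ⟨φh, hcont, hgraph⟩ := hcm.graph r
  have hG := hu.G_nonneg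
  have hL0 := hL.pos
  have hC0 : 0 ≤ C := by rw [hC]; positivity
  have hpU : p ∈ (c r).U := hball (Metric.mem_ball_self hu.delta_pos)
  have hpα := hc.base_mem_ball hΩ hpU
  set g := gradient (c r).φ ((c r).base p) with hg
  set s := ‖(c r).graphNormal ((c r).base p)‖ with hs
  have hs1 : 1 ≤ s := (c r).one_le_norm_graphNormal _
  have hs0 : 0 < s := by linarith
  have hgG : ‖g‖ ≤ G := hu.norm_gradient_le r _ hpα
  have hsG : s ≤ 1 + G := ((c r).norm_graphNormal_le _).trans (by linarith)
  have hinner : ∀ u w : Euc N, |inner ℝ (u - w) (outerNormal Ω p)| =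
      s⁻¹ * |((c r).height u - inner ℝ ((c r).base u) g) -
        ((c r).height w - inner ℝ ((c r).base w) g)| := by
    intro u w
    rw [outerNormal_chart hΩ hc hu hp hpU, real_inner_smul_right, BoundaryChart.inner_graphNormal,
      abs_mul, abs_inv, abs_norm, inner_sub_left, ← abs_neg, ← hs]
    congr 2; ring
  have hxU : x ∈ (c r).U := hball (by rw [mem_ball_iff_norm]; linarith)
  have hzU : z ∈ (c r).U := hball (by rw [mem_ball_iff_norm]; linarith)
  have hxg : x ∈ meshBoundary 𝒯 ∩ (c r).U := ⟨hx, hxU⟩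
  have hzg : z ∈ meshBoundary 𝒯 ∩ (c r).U := ⟨hz, hzU⟩
  rw [hgraph] at hxg hzg
  -- the segment between the base points, and the curve in the discrete boundary over it
  set y : ℝ → Euc (N - 1) := fun t => AffineMap.lineMap ((c r).base z) ((c r).base x) t with hy
  have hyc : Continuous y := AffineMap.lineMap_continuous
  have hynear : ∀ t ∈ Icc (0 : ℝ) 1, ‖y t - (c r).base p‖ ≤ 2 * h := by
    intro t ht
    rw [← mem_closedBall_iff_norm]
    refine (convex_closedBall ((c r).base p) (2 * h)).lineMap_mem ?_ ?_ ht
    · rw [mem_closedBall_iff_norm]; exact ((c r).norm_base_sub_le z p).trans hzp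
    · rw [mem_closedBall_iff_norm]; exact ((c r).norm_base_sub_le x p).trans hxp
  have hyα : ∀ t ∈ Icc (0 : ℝ) 1, y t ∈ Metric.ball 0 α := fun t ht =>
    hc.mem_ball_of_norm_sub_lt hΩ hball ((hynear t ht).trans_lt (by linarith))
  have hφc : ContinuousOn (fun t => φh (y t)) (Icc 0 1) := hcont.comp hyc.continuousOn hyα
  set γ : ℝ → Euc N := fun t => (c r).ofCoords (y t) (φh (y t)) with hγ
  have hγmem : ∀ t ∈ Icc (0 : ℝ) 1, γ t ∈ meshBoundary 𝒯 ∩ (c r).U := fun t ht =>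
    IsCompatibleMesh.ofCoords_mem hgraph (hyα t ht)
  set D := ‖(c r).base x - (c r).base z‖ with hD
  have hyD : ∀ a b : ℝ, a < b → ‖y b - y a‖ = D * (b - a) := by
    intro a b hab
    have : y b - y a = (b - a) • ((c r).base x - (c r).base z) := by
      simp only [hy, AffineMap.lineMap_apply_module']
      rw [add_sub_add_right_eq_sub, ← sub_smul]
    rw [this, norm_smul, Real.norm_of_nonneg (by linarith), mul_comm]
  have key := abs_sub_le_of_piecewise (f := fun t => φh (y t) - inner ℝ (y t) g) (γ := γ)
    (𝓕 := simplexOf '' boundaryFaces 𝒯) (M := 2 * (1 + G) ^ 2 * C * h * D)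
    (hφc.sub (hyc.inner continuous_const).continuousOn)
    ((c r).continuous_ofCoords hyc.continuousOn hφc)
    ((finite_boundaryFaces 𝒯).image _) ?_ ?_ ?_
  · have h0 : y 0 = (c r).base z := AffineMap.lineMap_apply_zero _ _
    have h1 : y 1 = (c r).base x := AffineMap.lineMap_apply_one _ _
    simp only [h0, h1] at key
    rw [← hxg.2, ← hzg.2] at key
    rw [hinner]
    have hDle : D ≤ ‖x - z‖ := (c r).norm_base_sub_le x z
    have h2 : 0 ≤ 2 * (1 + G) ^ 2 * C * h := by positivity
    calc s⁻¹ * _ ≤ 1 * (2 * (1 + G) ^ 2 * C * h * D) :=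
          mul_le_mul (inv_le_one_of_one_le₀ hs1) key (abs_nonneg _) zero_le_one
      _ ≤ _ := by rw [one_mul]; exact mul_le_mul_of_nonneg_left hDle h2
  · rintro A ⟨F, -, rfl⟩
    exact isClosed_simplexOf F
  · intro t ht
    obtain ⟨F, hF, hmem⟩ := mem_iUnion₂.1 (hγmem t ht).1
    exact ⟨_, ⟨F, hF, rfl⟩, hmem⟩
  · rintro A ⟨F, hF, rfl⟩ a ha b hb hab haF hbF
    obtain ⟨v, hv⟩ := exists_mem_of_mem_boundaryFaces hN hF
    have hvp := (hcm.face_near hm hΩ hc hu hp hball (hγmem a ha).2 (a := 2 * h)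
      (by simpa [hγ] using hynear a ha) (by linarith) hF haF hv).1
    have hslope := hm.abs_inner_face_le hN hσ hL hF (hcm.vertices_mem F hF) hv hp hbF haF
    rw [hinner] at hslope
    simp only [hγ, BoundaryChart.base_ofCoords, BoundaryChart.height_ofCoords] at hslope
    set T := φh (y b) - inner ℝ (y b) g - (φh (y a) - inner ℝ (y a) g) with hT
    have hcoef : 2 * N * L * σ * h + L * ‖p - v‖ ≤ C * h := by
      rw [norm_sub_rev, hC]
      have := mul_le_mul_of_nonneg_left hvp hL0.le
      nlinarith
    have hnorm : ‖(c r).ofCoords (y b) (φh (y b)) - (c r).ofCoords (y a) (φh (y a))‖ ≤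
        (1 + G) * (D * (b - a)) + |T| := by
      refine ((c r).norm_sub_le _ _).trans ?_
      simp only [BoundaryChart.base_ofCoords, BoundaryChart.height_ofCoords]
      have h1 : φh (y b) - φh (y a) = T + inner ℝ (y b - y a) g := by
        rw [hT, inner_sub_left]; ring
      have h2 := abs_real_inner_le_norm (y b - y a) g
      have h3 := abs_add_le T (inner ℝ (y b - y a) g)
      have h4 := mul_le_mul_of_nonneg_left hgG (norm_nonneg (y b - y a))
      rw [h1, ← hyD a b hab]
      linarith
    rw [inv_mul_le_iff₀ hs0] at hslope
    have hCh0 : 0 ≤ C * h := by positivity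
    have hba : 0 ≤ D * (b - a) := mul_nonneg (norm_nonneg _) (by linarith)
    have h5 : |T| ≤ (1 + G) * ((C * h) * ((1 + G) * (D * (b - a)) + |T|)) := by
      refine hslope.trans ?_
      gcongr
    have h6 := mul_le_mul_of_nonneg_right hCh (abs_nonneg T)
    nlinarith

end ChartMesh

/-! ### The normal displacement -/

section Displacement

variable {N M : ℕ} {Ω : Set (Euc N)} {α β δ K G L h σ : ℝ} {c : Fin M → BoundaryChart N}
  {𝒯 : Finset (Finset (Euc N))}

/-- Every normal line meets the discrete boundary near its foot: over the points `p ± τ n(p)` with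
`τ = 4 (1 + G) h` the height difference to `Γ_h` has opposite signs. -/
lemma IsCompatibleMesh.exists_add_smul_mem (hcm : IsCompatibleMesh Ω α c 𝒯)
    (hm : IsRegularMesh 𝒯 h σ) (hN : 2 ≤ N) (hh : 0 < h) (hΩ : IsOpen Ω)
    (hc : IsC11ChartSystem Ω α β c) (hu : UniformCharts Ω α c δ K G) {τ : ℝ}
    (hτ : τ = 4 * (1 + G) * h) (hδ : τ + h < δ) (hKτ : K * τ ≤ 1 / 4) {p : Euc N}
    (hp : p ∈ frontier Ω) :
    ∃ t : ℝ, |t| ≤ τ ∧ p + t • outerNormal Ω p ∈ meshBoundary 𝒯 := by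
  obtain ⟨r, hball⟩ := hu.exists_ball_subset p hp
  obtain ⟨φh, hcont, hgraph⟩ := hcm.graph r
  have hG := hu.G_nonneg
  have hK := hu.K_nonneg
  have hτ0 : 0 < τ := by rw [hτ]; positivity
  have hpU : p ∈ (c r).U := hball (Metric.mem_ball_self hu.delta_pos)
  have hpα := hc.base_mem_ball hΩ hpU
  have hpe := hc.height_eq hpU hp
  set g := gradient (c r).φ ((c r).base p) with hg
  set s := ‖(c r).graphNormal ((c r).base p)‖ with hs
  have hs1 : 1 ≤ s := (c r).one_le_norm_graphNormal _
  have hs0 : 0 < s := by linarith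
  have hs2 : s ^ 2 = ‖g‖ ^ 2 + 1 := (c r).norm_graphNormal_sq _
  have hgs : ‖g‖ ≤ s := by
    refine le_of_sq_le_sq ?_ hs0.le
    linarith
  set y : ℝ → Euc (N - 1) := fun t => (c r).base p + (t * s⁻¹) • g with hy
  have hyc : Continuous y := by fun_prop
  have hline : ∀ t : ℝ, p + t • outerNormal Ω p =
      (c r).ofCoords (y t) ((c r).φ ((c r).base p) - t * s⁻¹) := by
    intro t
    rw [outerNormal_chart hΩ hc hu hp hpU, smul_smul]
    refine (c r).ext_coords ?_ ?_
    · rw [BoundaryChart.base_add_smul_graphNormal, BoundaryChart.base_ofCoords]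
    · rw [BoundaryChart.height_add_smul_graphNormal, BoundaryChart.height_ofCoords, hpe]
  have hynear : ∀ t : ℝ, |t| ≤ τ → ‖y t - (c r).base p‖ ≤ τ := by
    intro t ht
    rw [hy, add_sub_cancel_left, norm_smul, Real.norm_eq_abs, abs_mul, abs_inv, abs_of_pos hs0,
      mul_assoc]
    have : s⁻¹ * ‖g‖ ≤ 1 := by rw [inv_mul_le_iff₀ hs0]; linarith
    calc |t| * (s⁻¹ * ‖g‖) ≤ |t| * 1 := mul_le_mul_of_nonneg_left this (abs_nonneg t)
      _ ≤ τ := by linarith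
  have hyα : ∀ t : ℝ, |t| ≤ τ → y t ∈ Metric.ball 0 α := fun t ht =>
    hc.mem_ball_of_norm_sub_lt hΩ hball ((hynear t ht).trans_lt (by linarith))
  set f : ℝ → ℝ := fun t => φh (y t) - ((c r).φ ((c r).base p) - t * s⁻¹) with hf
  -- the difference of heights is `t s` up to lower order terms
  have hest : ∀ t : ℝ, |t| ≤ τ → |f t - t * s| ≤ τ / 2 := by
    intro t ht
    have hmem := IsCompatibleMesh.ofCoords_mem hgraph (hyα t ht)
    obtain ⟨F, hF, hxF⟩ := mem_iUnion₂.1 hmem.1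
    obtain ⟨v, hv⟩ := exists_mem_of_mem_boundaryFaces hN hF
    have h1 := (hcm.face_near hm hΩ hc hu hp hball hmem.2 (a := τ)
      (by simpa using hynear t ht) hδ hF hxF hv).2
    rw [BoundaryChart.base_ofCoords, BoundaryChart.height_ofCoords] at h1
    have h2 := hu.abs_taylor_le r hpα (hyα t ht)
    have h3 : inner ℝ (y t - (c r).base p) g = t * s⁻¹ * ‖g‖ ^ 2 := by
      rw [hy, add_sub_cancel_left, real_inner_smul_left, real_inner_self_eq_norm_sq]
    rw [h3] at h2
    have h4 : K * ‖y t - (c r).base p‖ ^ 2 ≤ τ / 4 := by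
      have := mul_le_mul_of_nonneg_left
        (pow_le_pow_left₀ (norm_nonneg _) (hynear t ht) 2) hK
      nlinarith
    have h5 : f t - t * s = (φh (y t) - (c r).φ (y t)) +
        ((c r).φ (y t) - (c r).φ ((c r).base p) - t * s⁻¹ * ‖g‖ ^ 2) := by
      have : t * s = t * s⁻¹ * (‖g‖ ^ 2 + 1) := by rw [← hs2]; field_simp
      rw [this, hf]; ring
    rw [h5]
    refine (abs_add_le _ _).trans ?_
    have h6 : (1 + G) * h = τ / 4 := by rw [hτ]; ring
    linarith
  have hfc : ContinuousOn f (Icc (-τ) τ) := by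
    refine ContinuousOn.sub (hcont.comp hyc.continuousOn fun t ht => hyα t (abs_le.2 ht)) ?_
    fun_prop
  have hneg : f (-τ) ≤ 0 := by
    have := (abs_le.1 (hest (-τ) (by rw [abs_neg, abs_of_pos hτ0]))).2
    nlinarith
  have hpos : 0 ≤ f τ := by
    have := (abs_le.1 (hest τ (by rw [abs_of_pos hτ0]))).1
    nlinarith
  obtain ⟨t, ht, hft⟩ := intermediate_value_Icc (by linarith) hfc ⟨hneg, hpos⟩
  refine ⟨t, abs_le.2 ht, ?_⟩
  have hmem := IsCompatibleMesh.ofCoords_mem hgraph (hyα t (abs_le.2 ht))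
  rw [hline, ← sub_eq_zero.1 hft]
  exact hmem.1

/-- The displacement `t` in `p + t n(p) ∈ Γ_h` varies slowly with `p`; for `p = q` this says that a
normal line meets `Γ_h` only once. -/
lemma IsCompatibleMesh.abs_disp_sub_le (hcm : IsCompatibleMesh Ω α c 𝒯)
    (hm : IsRegularMesh 𝒯 h σ) (hN : 2 ≤ N) (hσ : 0 < σ) (hh : 0 < h) (hΩ : IsOpen Ω)
    (hc : IsC11ChartSystem Ω α β c) (hu : UniformCharts Ω α c δ K G)
    (hL : HasLipschitzNormal Ω L) {C C' : ℝ} (hC : C = 2 * N * L * σ + 3 * L * (1 + G))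
    (hC' : C' = 2 * (1 + G) ^ 2 * C) (hδ : 3 * h < δ) (hCh : (1 + G) * (C * h) ≤ 1 / 2)
    (hC'h : C' * h ≤ 1 / 2) (hLh : h * L ≤ 1)
    {p q : Euc N} (hp : p ∈ frontier Ω) (hq : q ∈ frontier Ω) {t s : ℝ}
    (hx : p + t • outerNormal Ω p ∈ meshBoundary 𝒯)
    (hz : q + s • outerNormal Ω q ∈ meshBoundary 𝒯) (ht : |t| ≤ h) (hs : |s| ≤ h)
    (hpq : ‖p - q‖ ≤ h) : |t - s| ≤ (4 * C' + 4 * L) * h * ‖p - q‖ := by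
  have hL0 := hL.pos
  have hG := hu.G_nonneg
  have hn := hL.norm_normal hp
  have hm' := hL.norm_normal hq
  have hsL : |s| * L ≤ 1 := (mul_le_mul_of_nonneg_right hs hL0.le).trans hLh
  have hC'0 : 0 ≤ C' := by rw [hC', hC]; positivity
  have h1 := hL.abs_sub_le hp hq (t := t) hsL
  have hxp : ‖(p + t • outerNormal Ω p) - p‖ ≤ 2 * h := by
    rw [add_sub_cancel_left, norm_smul, hn, mul_one, Real.norm_eq_abs]; linarith
  have hzp : ‖(q + s • outerNormal Ω q) - p‖ ≤ 2 * h := by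
    rw [show q + s • outerNormal Ω q - p = s • outerNormal Ω q - (p - q) by abel]
    refine (norm_sub_le _ _).trans ?_
    rw [norm_smul, hm', mul_one, Real.norm_eq_abs]; linarith
  have h2 := hcm.abs_inner_le hm hN hσ hh hΩ hc hu hL hC hδ hCh hp hx hz hxp hzp
  rw [← hC'] at h2
  have h3 : ‖(p + t • outerNormal Ω p) - (q + s • outerNormal Ω q)‖ ≤
      2 * ‖p - q‖ + |t - s| := by
    have h4 : (p + t • outerNormal Ω p) - (q + s • outerNormal Ω q) = (p - q) +
        ((t - s) • outerNormal Ω p + s • (outerNormal Ω p - outerNormal Ω q)) := by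
      rw [sub_smul, smul_sub]; abel
    rw [h4]
    refine (norm_add_le _ _).trans ?_
    have h5 := norm_add_le ((t - s) • outerNormal Ω p)
      (s • (outerNormal Ω p - outerNormal Ω q))
    rw [norm_smul, norm_smul, hn, mul_one, Real.norm_eq_abs, Real.norm_eq_abs] at h5
    have h6 := mul_le_mul_of_nonneg_left (hL.normal_sub_le p hp q hq) (abs_nonneg s)
    have h7 := mul_le_mul_of_nonneg_right hsL (norm_nonneg (p - q))
    linarith
  have h4 := mul_le_mul_of_nonneg_left h3 (mul_nonneg hC'0 hh.le)
  have h5 := mul_le_mul_of_nonneg_right hC'h (abs_nonneg (t - s))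
  have h6 : L * ‖p - q‖ ^ 2 ≤ L * h * ‖p - q‖ := by
    have := mul_le_mul_of_nonneg_right hpq (norm_nonneg (p - q))
    nlinarith
  linarith

/-- The properties of the projection and of the displacement on a fine compatible mesh, with the
Lipschitz constant `B` of the displacement. -/
structure HasNormalGraph (Ω : Set (Euc N)) (𝒯 : Finset (Finset (Euc N))) (A B : ℝ) : Prop where
  existsUnique : ∀ x ∈ meshBoundary 𝒯, ∃! p, IsOrthProj Ω x p
  dist_le : ∀ x ∈ meshBoundary 𝒯, ‖orthProj Ω x - x‖ ≤ A
  bijOn : BijOn (orthProj Ω) (meshBoundary 𝒯) (frontier Ω)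
  projInv_eq : ∀ p ∈ frontier Ω, projInv Ω 𝒯 p = p + normalDisp Ω 𝒯 p • outerNormal Ω p
  abs_disp_le : ∀ p ∈ frontier Ω, |normalDisp Ω 𝒯 p| ≤ A
  abs_disp_sub_le : ∀ p ∈ frontier Ω, ∀ q ∈ frontier Ω,
    |normalDisp Ω 𝒯 p - normalDisp Ω 𝒯 q| ≤ B * ‖p - q‖

lemma IsCompatibleMesh.hasNormalGraph (hcm : IsCompatibleMesh Ω α c 𝒯)
    (hm : IsRegularMesh 𝒯 h σ) (hN : 2 ≤ N) (hσ : 0 < σ) (hh : 0 < h) (hΩ : IsOpen Ω)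
    (hΩb : Bornology.IsBounded Ω)
    (hc : IsC11ChartSystem Ω α β c) (hu : UniformCharts Ω α c δ K G)
    (hL : HasLipschitzNormal Ω L) {C C' τ : ℝ} (hC : C = 2 * N * L * σ + 3 * L * (1 + G))
    (hC' : C' = 2 * (1 + G) ^ 2 * C) (hδ : 3 * h < δ) (hCh : (1 + G) * (C * h) ≤ 1 / 2)
    (hC'h : C' * h ≤ 1 / 2) (hLh : h * L ≤ 1 / 16)
    (hτ : τ = 4 * (1 + G) * h) (hδτ : τ + h < δ) (hKτ : K * τ ≤ 1 / 4) (hLτ : τ * L ≤ 1 / 16) :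
    HasNormalGraph Ω 𝒯 (4 * L * h ^ 2) ((4 * C' + 12 * L) * h) := by
  have hL0 := hL.pos
  have hG := hu.G_nonneg
  have hC'0 : 0 ≤ C' := by rw [hC', hC]; positivity
  have hsq : 4 * L * h ^ 2 ≤ h := by nlinarith
  have hex : ∀ x ∈ meshBoundary 𝒯, ∃! p, IsOrthProj Ω x p := by
    intro x hx
    obtain ⟨F, hF, hxF⟩ := mem_iUnion₂.1 hx
    obtain ⟨v, hv⟩ := exists_mem_of_mem_boundaryFaces hN hF
    have h1 := hm.infDist_le hN hF (hcm.vertices_mem F hF) hxF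
    exact hL.existsUnique_isOrthProj hΩ hΩb ⟨v, hcm.vertices_mem F hF v hv⟩
      ((mul_le_mul_of_nonneg_right h1 hL0.le).trans hLh)
  have hproj : ∀ x ∈ meshBoundary 𝒯, IsOrthProj Ω x (orthProj Ω x) := fun x hx =>
    Classical.epsilon_spec (p := fun p => IsOrthProj Ω x p) (hex x hx).exists
  have hdist : ∀ x ∈ meshBoundary 𝒯, |bdrySignedDist Ω x| ≤ 4 * L * h ^ 2 := by
    intro x hx
    obtain ⟨F, hF, hxF⟩ := mem_iUnion₂.1 hx
    exact hm.abs_bdrySignedDist_le hN hL hF (hcm.vertices_mem F hF) hxF (hproj x hx)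
  have hinj : InjOn (orthProj Ω) (meshBoundary 𝒯) := by
    intro x hx z hz hxz
    have hpx := hproj x hx
    have hpz := hproj z hz
    rw [← hxz] at hpz
    have h1 := hcm.abs_disp_sub_le hm hN hσ hh hΩ hc hu hL hC hC' hδ hCh hC'h (by linarith)
      hpx.1 hpz.1 (hpx.2 ▸ hx) (hpz.2 ▸ hz) ((hdist x hx).trans hsq) ((hdist z hz).trans hsq)
      (by simpa using hh.le)
    rw [sub_self, norm_zero, mul_zero] at h1
    rw [hpx.2, hpz.2, sub_eq_zero.1 (abs_nonpos_iff.1 h1)]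
  have hbij : BijOn (orthProj Ω) (meshBoundary 𝒯) (frontier Ω) := by
    refine ⟨fun x hx => (hproj x hx).1, hinj, fun p hp => ?_⟩
    obtain ⟨t, ht, hmem⟩ := hcm.exists_add_smul_mem hm hN hh hΩ hc hu hτ hδτ hKτ hp
    exact ⟨_, hmem, orthProj_eq (hex _ hmem) (hL.isOrthProj_add_smul hΩ hΩb hp
      ((mul_le_mul_of_nonneg_right ht hL0.le).trans hLτ))⟩
  have hinv : ∀ p ∈ frontier Ω, projInv Ω 𝒯 p ∈ meshBoundary 𝒯 ∧
      normalDisp Ω 𝒯 p = bdrySignedDist Ω (projInv Ω 𝒯 p) ∧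
      projInv Ω 𝒯 p = p + normalDisp Ω 𝒯 p • outerNormal Ω p := by
    intro p hp
    have hpre := hbij.surjOn hp
    have hmem : projInv Ω 𝒯 p ∈ meshBoundary 𝒯 := Function.invFunOn_mem hpre
    have heq : orthProj Ω (projInv Ω 𝒯 p) = p := Function.invFunOn_eq hpre
    have h1 := hproj _ hmem
    rw [heq] at h1
    have h2 : normalDisp Ω 𝒯 p = bdrySignedDist Ω (projInv Ω 𝒯 p) := by
      have h3 : projInv Ω 𝒯 p - p = bdrySignedDist Ω (projInv Ω 𝒯 p) • outerNormal Ω p := by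
        conv_lhs => rw [h1.2]
        rw [add_sub_cancel_left]
      rw [normalDisp, h3, real_inner_smul_left, real_inner_self_eq_norm_sq, hL.norm_normal hp]
      ring
    exact ⟨hmem, h2, by rw [h2]; exact h1.2⟩
  have habs : ∀ p ∈ frontier Ω, |normalDisp Ω 𝒯 p| ≤ 4 * L * h ^ 2 := by
    intro p hp
    rw [(hinv p hp).2.1]
    exact hdist _ (hinv p hp).1
  refine ⟨hex, fun x hx => ?_, hbij, fun p hp => (hinv p hp).2.2, habs, fun p hp q hq => ?_⟩
  · have h1 := hproj x hx
    have h2 : orthProj Ω x - x = -(bdrySignedDist Ω x • outerNormal Ω (orthProj Ω x)) := by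
      rw [sub_eq_iff_eq_add, neg_add_eq_sub, eq_sub_iff_add_eq]
      exact h1.2.symm
    rw [h2, norm_neg, norm_smul, hL.norm_normal h1.1, mul_one]
    exact hdist x hx
  · rcases le_or_gt ‖p - q‖ h with hnear | hfar
    · have h1 := hcm.abs_disp_sub_le hm hN hσ hh hΩ hc hu hL hC hC' hδ hCh hC'h (by linarith)
        hp hq ((hinv p hp).2.2 ▸ (hinv p hp).1) ((hinv q hq).2.2 ▸ (hinv q hq).1)
        ((habs p hp).trans hsq) ((habs q hq).trans hsq) hnear
      have h2 : 0 ≤ L * h * ‖p - q‖ := by positivity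
      linarith
    · -- at distances above `h` the bound of order `h²` on the displacement itself is sufficient
      have h1 := abs_sub (normalDisp Ω 𝒯 p) (normalDisp Ω 𝒯 q)
      have h2 := mul_le_mul_of_nonneg_left hfar.le (show 0 ≤ 8 * L * h by positivity)
      have h3 : 0 ≤ (4 * C' + 4 * L) * h * ‖p - q‖ := by positivity
      linarith [habs p hp, habs q hq]

lemma UniformCharts.norm_param_sub_le (hu : UniformCharts Ω α c δ K G) (r : Fin M)
    {y z : Euc (N - 1)} (hy : y ∈ Metric.ball (0 : Euc (N - 1)) α)
    (hz : z ∈ Metric.ball (0 : Euc (N - 1)) α) :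
    ‖(c r).param y - (c r).param z‖ ≤ (1 + G) * ‖y - z‖ := by
  have h1 := (c r).norm_sub_le ((c r).ofCoords y ((c r).φ y)) ((c r).ofCoords z ((c r).φ z))
  simp only [BoundaryChart.base_ofCoords, BoundaryChart.height_ofCoords] at h1
  have h2 := hu.abs_sub_le r hz hy
  have h3 : ‖(c r).param y - (c r).param z‖ ≤ ‖y - z‖ + |(c r).φ y - (c r).φ z| := h1
  linarith

lemma ae_differentiableAt_of_lipschitzOnWith {E : Type*} [NormedAddCommGroup E]
    [InnerProductSpace ℝ E] [FiniteDimensional ℝ E] [MeasurableSpace E] [BorelSpace E]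
    {μ : Measure E} [μ.IsAddHaarMeasure] {f : E → ℝ} {s : Set E} (hs : IsOpen s) {C : NNReal}
    (hf : LipschitzOnWith C f s) :
    ∀ᵐ y ∂(μ.restrict s), DifferentiableAt ℝ f y ∧ ‖gradient f y‖ ≤ C := by
  filter_upwards [hf.ae_differentiableWithinAt hs.measurableSet,
    ae_restrict_mem hs.measurableSet] with y hy hys
  have hnhds := hs.mem_nhds hys
  refine ⟨hy.differentiableAt hnhds, ?_⟩
  rw [gradient, LinearIsometryEquiv.norm_map]
  exact norm_fderiv_le_of_lipschitzOn ℝ hnhds hf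

end Displacement

theorem mainTheorem6 (N : ℕ) (hN : 2 ≤ N) (Ω : Set (Euc N)) (hΩ_open : IsOpen Ω)
    (hΩ_conn : IsConnected Ω) (hΩ_bdd : Bornology.IsBounded Ω)
    (M : ℕ) (α β : ℝ) (c : Fin M → BoundaryChart N) (hc : IsC11ChartSystem Ω α β c) :
    ∃ C₀ : ℝ, 0 < C₀ ∧ ∀ σ : ℝ, 0 < σ → ∃ C₁ : ℝ, 0 < C₁ ∧ ∃ h₀ : ℝ, 0 < h₀ ∧
      ∀ h : ℝ, 0 < h → h < h₀ → ∀ 𝒯 : Finset (Finset (Euc N)),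
        IsRegularMesh 𝒯 h σ → IsCompatibleMesh Ω α c 𝒯 →
        -- the projection, its inverse and the displacement are well defined
        (∀ x ∈ meshBoundary 𝒯, ∃! p, IsOrthProj Ω x p) ∧
        Set.BijOn (orthProj Ω) (meshBoundary 𝒯) (frontier Ω) ∧
        (∀ p ∈ frontier Ω,
          projInv Ω 𝒯 p = p + normalDisp Ω 𝒯 p • outerNormal Ω p) ∧
        ∀ F ∈ boundaryFaces 𝒯,
          (∃ r, simplexOf F ∪ orthProj Ω '' simplexOf F ⊆ (c r).U) ∧
          ∀ r, simplexOf F ∪ orthProj Ω '' simplexOf F ⊆ (c r).U →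
            -- the displacement is bounded by `C₀ h²` on the base set
            (∀ y ∈ baseSet Ω (c r) F, |chartDisp Ω 𝒯 (c r) y| ≤ C₀ * h ^ 2) ∧
            -- it is Lipschitz there, and its gradient is bounded by `C₁ h` almost everywhere
            (∃ K : NNReal, LipschitzOnWith K (chartDisp Ω 𝒯 (c r)) (baseSet Ω (c r) F)) ∧
            (∀ᵐ y ∂(MeasureTheory.volume.restrict (baseSet Ω (c r) F)),
              DifferentiableAt ℝ (chartDisp Ω 𝒯 (c r)) y ∧
                ‖gradient (chartDisp Ω 𝒯 (c r)) y‖ ≤ C₁ * h) := by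
  obtain ⟨δ, K, G, hu⟩ := hc.exists_uniformCharts hΩ_bdd
  obtain ⟨L, hL⟩ := hu.exists_hasLipschitzNormal hΩ_open hc
  have hL0 := hL.pos
  have hG := hu.G_nonneg
  have hK := hu.K_nonneg
  have hδ := hu.delta_pos
  refine ⟨4 * L, by positivity, fun σ hσ => ?_⟩
  obtain ⟨C, hC⟩ : ∃ C : ℝ, C = 2 * N * L * σ + 3 * L * (1 + G) := ⟨_, rfl⟩
  obtain ⟨C', hC'⟩ : ∃ C' : ℝ, C' = 2 * (1 + G) ^ 2 * C := ⟨_, rfl⟩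
  have hC0 : 0 ≤ C := by rw [hC]; positivity
  have hC'0 : 0 ≤ C' := by rw [hC']; positivity
  -- `h < 1 / A` makes each of the finitely many products of `h` with a summand of `A` less than one
  obtain ⟨A, hA⟩ : ∃ A : ℝ, A = 8 * (1 + G) / δ + 2 * (1 + G) * C + 2 * C' +
      64 * (1 + G) * L + 16 * (1 + G) * K := ⟨_, rfl⟩
  have hApos : 0 < A := by rw [hA]; positivity
  refine ⟨(4 * C' + 12 * L) * (1 + G), by positivity, 1 / A, by positivity,
    fun h hh hhA 𝒯 hm hcm => ?_⟩
  rw [lt_div_iff₀ hApos, hA] at hhA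
  have e1 : 0 ≤ h * (8 * (1 + G) / δ) := by positivity
  have e2 : 0 ≤ h * (2 * (1 + G) * C) := by positivity
  have e3 : 0 ≤ h * (2 * C') := by positivity
  have e4 : 0 ≤ h * (64 * (1 + G) * L) := by positivity
  have e5 : 0 ≤ h * (16 * (1 + G) * K) := by positivity
  have hGh : 0 ≤ G * h := by positivity
  have hδh : 8 * (1 + G) * h < δ := by
    have : h * (8 * (1 + G) / δ) < 1 := by linarith
    rw [← mul_div_assoc, div_lt_one hδ] at this
    linarith
  have hGL : 0 ≤ G * L * h := by positivity
  have hng := hcm.hasNormalGraph hm hN hσ hh hΩ_open hΩ_bdd hc hu hL hC hC' (by linarith)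
    (by linarith) (by linarith) (by linarith) rfl (by linarith) (by linarith) (by linarith)
  have hsq : 4 * L * h ^ 2 ≤ h := by
    have : L * h ≤ 1 / 64 := by linarith
    nlinarith
  refine ⟨hng.existsUnique, hng.bijOn, hng.projInv_eq, fun F hF => ⟨?_, fun r hr => ?_⟩⟩
  · obtain ⟨v, hv⟩ := exists_mem_of_mem_boundaryFaces hN hF
    obtain ⟨r, hball⟩ := hu.exists_ball_subset v (hcm.vertices_mem F hF v hv)
    have hFv : ∀ x ∈ simplexOf F, ‖x - v‖ ≤ h := fun x hx =>
      hm.norm_sub_le hF hx (mem_simplexOf hv)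
    refine ⟨r, union_subset (fun x hx => hball ?_) ?_⟩
    · rw [mem_ball_iff_norm]; linarith [hFv x hx]
    · rintro _ ⟨x, hx, rfl⟩
      refine hball ?_
      rw [mem_ball_iff_norm]
      have h1 := hng.dist_le x (mem_biUnion hF hx)
      have h2 := norm_sub_le_norm_sub_add_norm_sub (orthProj Ω x) x v
      linarith [hFv x hx]
  · have hsub : baseSet Ω (c r) F ⊆ Metric.ball 0 α := by
      rintro _ ⟨p, hp, rfl⟩
      exact hc.base_mem_ball hΩ_open (hr (Or.inr hp))
    have hB : 0 ≤ (4 * C' + 12 * L) * (1 + G) * h := by positivity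
    have hlip : LipschitzOnWith (NNReal.mk ((4 * C' + 12 * L) * (1 + G) * h) hB) (chartDisp Ω 𝒯 (c r))
        (Metric.ball 0 α) := by
      refine LipschitzOnWith.of_dist_le_mul fun y hy z hz => ?_
      rw [Real.dist_eq, dist_eq_norm, NNReal.coe_mk]
      have h1 := hng.abs_disp_sub_le _ (hc.param_mem r hy).1 _ (hc.param_mem r hz).1
      have h2 := mul_le_mul_of_nonneg_left (hu.norm_param_sub_le r hy hz)
        (show 0 ≤ (4 * C' + 12 * L) * h by positivity)
      exact h1.trans (h2.trans_eq (by ring))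
    refine ⟨fun y hy => hng.abs_disp_le _ (hc.param_mem r (hsub hy)).1, ⟨_, hlip.mono hsub⟩, ?_⟩
    exact ae_restrict_of_ae_restrict_of_subset hsub
      (ae_differentiableAt_of_lipschitzOnWith Metric.isOpen_ball hlip)
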